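/- **Setting.** Let $X$ and $Y$ be separable real Hilbert spaces (for instance $Y=\mathbb R^J$) with their Borel $\sigma$-algebras, let $\mathcal G_a:X\to Y$ be measurable, and let $x$ (with values in $X$) and $\epsilon,\eta$ (with values in $Y$) be random variables such that $x\sim\mu_0=\mathcal N(\bar x,\mathcal C_x)$, $\eta\sim\mathbb Q_0=\mathcal N(0,\mathcal C_\eta)$ and $\epsilon\sim\mathcal N(\bar\epsilon,\mathcal C_\epsilon)$ are Gaussian (with non-negative trace-class covariance operators), $\eta$ is independent of $x$, and $\eta$ is independent of $\epsilon$. The data are $y=\mathcal G_a(x)+\epsilon+\eta$. Let $E$ be the Cameron–Martin space of $\mu_0$, that is $E=\operatorname{Im}\mathcal C_x^{1/2}$ with norm $$\|h\|_E=\sup\{L(h): L\in X^*,\ \operatorname{Var}_{\mu_0}(L)\le 1\}=\|\mathcal C_x^{-1/2}h\|_X .$$ For a potential $\Phi:X\times Y\to\mathbb R$ and a datum $v\in Y$ let $$I(u)=\Phi(u;v)+\tfrac12\|u-\bar x\|_E^2\ \text{ if } u-\bar x\in E,\qquad I(u)=+\infty\ \text{ otherwise.}$$ For a measure $\mu$ on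 $X$ put $M^\delta=\sup_{w\in X}\mu(B_\delta(w))$, where $B_\delta(w)$ is the open ball. A point $\hat x$ is a *MAP estimator* for $\mu$ if $\lim_{\delta\to0+}\mu(B_\delta(\hat x))/M^\delta=1$. **Theorem.** Let $\Phi:X\times Y\to\mathbb R$, and let $v\in Y$ be such that $\Phi(\cdot\,;v)$ is Lipschitz on bounded subsets of $X$ and there is $M\in\mathbb R$ with $\Phi(u;v)\ge M$ for all $u\in X$. Let $$\mu^v(du)=\frac1{Z(v)}e^{-\Phi(u;v)}\,\mu_0(du),\qquad Z(v)=\int_X e^{-\Phi(u;v)}\,\mu_0(du).$$ Then: 1. For every $\delta>0$ the maximum of $w\mapsto\mu^v(B_\delta(w))$ over $X$ is attained. 2. For every choice of maximisers $z^\delta\in\operatorname{argmax}_{w\in X}\mu^v(B_\delta(w))$, $\delta>0$, and every sequence of radii $\delta_n>0$ with $\delta_n\to0$, there are a point $\bar z$ with $\bar z-\bar x\in E$ and a subsequence of $(z^{\delta_n})_n$ that converges to $\bar z$ strongly in $X$; moreover $\bar z$ is a MAP estimator for $\mu^v$ and minimises $I$ over $X$. Suppose in addition that $\Phi$ is a potential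 of the observation model: $\Phi$ is measurable with respect to (the completion of) $\mu_0\otimes\mathbb Q_0$ and, for $\mu_0$-almost every $u$, the conditional law of $y$ given $x=u$ is absolutely continuous with respect to $\mathbb Q_0$ with density $v\mapsto e^{-\Phi(u;v)}/c(v)$, where $c:Y\to(0,\infty)$ is measurable and does not depend on $u$. Then, for almost every $v$ with respect to the law of $y$, the following holds: if $\Phi(\cdot\,;v)$ is Lipschitz on bounded sets and bounded below, then 1 and 2 are also true with $\mu^v$ replaced by the conditional law of $x$ given $y=v$. -/

import Mathlib

open MeasureTheory ProbabilityTheory Filter Topology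
open scoped ENNReal RealInnerProductSpace

noncomputable section

section Gaussian

variable {X : Type*} [NormedAddCommGroup X] [InnerProductSpace ℝ X] [CompleteSpace X]
  [MeasurableSpace X] [BorelSpace X]

/-- `μ` is the Gaussian measure `N(m, C)` on the Hilbert space `X`: it is Gaussian with mean `m` and
covariance operator `C`, i.e. `⟪C u, w⟫ = Cov(⟪u, ·⟫, ⟪w, ·⟫)`. (The covariance operator of a
Gaussian measure on a separable Hilbert space is always self-adjoint, non-negative and of trace
class, so this need not be demanded.) -/
structure IsGaussianWith (μ : Measure X) (m : X) (C : X →L[ℝ] X) : Prop where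
  isGaussian : IsGaussian μ
  mean_eq : ∫ u, u ∂μ = m
  covariance_eq : ∀ u w : X, ⟪C u, w⟫ = cov[fun v => ⟪u, v⟫, fun v => ⟪w, v⟫; μ]

end Gaussian

section CameronMartin

variable {X : Type*} [NormedAddCommGroup X] [InnerProductSpace ℝ X] [MeasurableSpace X]

/-- The Cameron--Martin norm `‖h‖_E = sup {L h | L ∈ X*, Var_μ(L) ≤ 1} ∈ [0, ∞]` of a vector `h`
with respect to a Gaussian measure `μ`, i.e. `‖C^{-1/2} h‖` for the covariance operator `C` of `μ`
(and `∞` if `h` is not in the range of `C^{1/2}`). -/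
def cameronMartinNorm (μ : Measure X) (h : X) : ℝ≥0∞ :=
  ⨆ (L : StrongDual ℝ X) (_ : Var[fun u => L u; μ] ≤ 1), ENNReal.ofReal (L h)

/-- The Cameron--Martin space `E` of a Gaussian measure `μ` (a linear space of directions, also
when `μ` is not centred). -/
def cameronMartinSpace (μ : Measure X) : Set X :=
  {h | cameronMartinNorm μ h < ∞}

open Classical in
/-- The Onsager--Machlup functional of the potential `φ` and the Gaussian measure `μ₀` with
mean `xbar`. -/
def onsagerMachlup (μ₀ : Measure X) (xbar : X) (φ : X → ℝ) (u : X) : EReal :=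
  if u - xbar ∈ cameronMartinSpace μ₀ then
    ((φ u + 1 / 2 * (cameronMartinNorm μ₀ (u - xbar)).toReal ^ 2 : ℝ) : EReal)
  else ⊤

end CameronMartin

section Modes

variable {X : Type*} [NormedAddCommGroup X] [MeasurableSpace X]

/-- `z` is a point whose (open) `δ`-ball has maximal `μ`-measure among all `δ`-balls:
`z ∈ argmax_{w} μ(B_δ(w))`. -/
def IsMaximalBallCentre (μ : Measure X) (δ : ℝ) (z : X) : Prop :=
  ∀ w : X, μ (Metric.ball w δ) ≤ μ (Metric.ball z δ)

/-- MAP estimates of a measure: `μ(B_δ(z)) / sup_w μ(B_δ(w)) → 1` as `δ → 0+`. -/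
def IsMAPEstimate (μ : Measure X) (z : X) : Prop :=
  Tendsto (fun δ : ℝ => μ (Metric.ball z δ) / ⨆ w : X, μ (Metric.ball w δ)) (𝓝[>] 0) (𝓝 1)

/-- A function on `X` that is Lipschitz on bounded sets. -/
def LipschitzOnBounded (φ : X → ℝ) : Prop :=
  ∀ r : ℝ, 0 < r → ∃ K : ℝ, 0 < K ∧
    ∀ u v : X, ‖u‖ < r → ‖v‖ < r → |φ u - φ v| ≤ K * ‖u - v‖

/-- The measure `Z⁻¹ exp(-φ) μ₀` with `Z = ∫ exp(-φ) dμ₀`. -/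
def bayesPosterior (μ₀ : Measure X) (φ : X → ℝ) : Measure X :=
  μ₀.withDensity fun u =>
    ENNReal.ofReal (Real.exp (-φ u)) / ∫⁻ v, ENNReal.ofReal (Real.exp (-φ v)) ∂μ₀

end Modes

section Model

variable {Ω X Y : Type*} [MeasurableSpace Ω]
  [NormedAddCommGroup X] [InnerProductSpace ℝ X] [CompleteSpace X] [SecondCountableTopology X]
  [MeasurableSpace X] [BorelSpace X]
  [NormedAddCommGroup Y] [InnerProductSpace ℝ Y] [CompleteSpace Y] [SecondCountableTopology Y]
  [MeasurableSpace Y] [BorelSpace Y]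

/-- Assumptions on the unknown `x`, the model reduction error `ε` and the noise `η`. -/
structure GaussianModel (P : Measure Ω) (x : Ω → X) (ε η : Ω → Y)
    (xbar : X) (εbar : Y) (Cx : X →L[ℝ] X) (Cε Cη : Y →L[ℝ] Y) : Prop where
  measurable_x : Measurable x
  measurable_ε : Measurable ε
  measurable_η : Measurable η
  prior : IsGaussianWith (P.map x) xbar Cx
  noise : IsGaussianWith (P.map η) 0 Cη
  modelError : IsGaussianWith (P.map ε) εbar Cε
  indep_η_x : IndepFun η x P
  indep_η_ε : IndepFun η ε P

/-- `Φ` is a potential for the data `y` given the unknown `x` relative to the measure `Q₀`: it is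
measurable with respect to (the completion of) `μ₀ ⊗ Q₀`, where `μ₀` is the law of `x`, and for
`μ₀`-almost every `u` the conditional law of `y` given `x = u` is absolutely continuous with
respect to `Q₀`, with density `v ↦ exp(-Φ(u; v)) / c(v)` for a positive factor `c` that does not
depend on `u`. -/
structure IsPotential (P : Measure Ω) [IsFiniteMeasure P] (x : Ω → X) (y : Ω → Y) (Q₀ : Measure Y)
    (Φ : X → Y → ℝ) : Prop where
  aemeasurable : AEMeasurable (Function.uncurry Φ) ((P.map x).prod Q₀)
  density : ∃ c : Y → ℝ, Measurable c ∧ (∀ v, 0 < c v) ∧ ∀ᵐ u ∂(P.map x),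
    condDistrib y x P u ≪ Q₀ ∧
    (condDistrib y x P u).rnDeriv Q₀ =ᵐ[Q₀] fun v => ENNReal.ofReal (Real.exp (-Φ u v) / c v)

end Model

/-- The behaviour of the centres of maximal-probability balls of `μ`: they exist for every radius,
and for every choice `z δ` of them and every sequence of radii tending to `0` there is a subsequence
along which `z` converges in norm to a point `zbar ∈ xbar + E` which is a MAP estimate of `μ` and
minimises the Onsager--Machlup functional. -/
def MaximalBallCentresConverge {X : Type*} [NormedAddCommGroup X] [InnerProductSpace ℝ X]
    [MeasurableSpace X] (μ₀ : Measure X) (xbar : X) (φ : X → ℝ) (μ : Measure X) : Prop :=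
  (∀ δ : ℝ, 0 < δ → ∃ z : X, IsMaximalBallCentre μ δ z) ∧
  ∀ z : ℝ → X, (∀ δ : ℝ, 0 < δ → IsMaximalBallCentre μ δ (z δ)) →
    ∀ δ : ℕ → ℝ, (∀ n, 0 < δ n) → Tendsto δ atTop (𝓝 0) →
      ∃ (k : ℕ → ℕ) (zbar : X), StrictMono k ∧
        zbar - xbar ∈ cameronMartinSpace μ₀ ∧
        Tendsto (fun n => z (δ (k n))) atTop (𝓝 zbar) ∧
        IsMAPEstimate μ zbar ∧
        ∀ u : X, onsagerMachlup μ₀ xbar φ zbar ≤ onsagerMachlup μ₀ xbar φ u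

end

/-!
Let `μ` be the Gaussian prior with mean `m` and covariance operator `C`, and let
`Q a w = ⟪a, w⟫ - ⟪C a, a⟫ / 2`. The supremum of `Q a w` over `a` is half the squared
Cameron–Martin norm of `w` (`IsGaussianWith.isLUB_cameronMartinNorm`). The proof rests on a two-sided
estimate for the measure of a small ball around `z`, relative to that of the ball around the mean:

* it is at most `exp (-Q a (z - m) + δ * ‖a‖)` for every vector `a`
  (`IsGaussianWith.measure_ball_le_exp_mul_mean`);
* it is at least `exp (-J)` if `Q a (z - m) ≤ J` for all `a`
  (`IsGaussianWith.exp_mul_measure_ball_mean_le`).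

Both follow from the Cameron–Martin formula for shifts by `C a` (`IsGaussianWith.map_add_range`). The
lower bound for `z - m = C a` is the symmetry of the centred measure, and it extends to the
Cameron–Martin space by Tikhonov regularisation. The upper bound uses Anderson's inequality for
balls. For the latter, a ball around `w` is moved to `w - t • C w`: by symmetry this decreases its
measure at most by the factor `exp (-t ^ 2 * ⟪C w, w⟫ / 2)`, whereas `‖w‖ ^ 2` decreases to first
order in `t`. Hence a maximiser of the measure of the ball times `exp (-κ * ‖w‖ ^ 2)`, which exists
by weak compactness, satisfies `⟪C w, w⟫ = 0`; such a ball is no more likely than the one around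
the mean, and `κ` tends to zero.

For centres `z` of maximal balls of the posterior `exp (-φ) μ / Z`, comparison with the ball around
`m` gives `Q a (z - m) ≤ K + δ * ‖a‖` for all `a`, with a constant `K`. Hence the centres are bounded,
and a weak limit belongs to the Cameron–Martin space; inserting large multiples of the difference to
the weak limit for `a` gives strong convergence, since the covariance form is weakly continuous on
bounded sets (`IsGaussianWith.exists_subseq_tendsto`). As `φ` is nearly constant on small balls,
comparing the ball around the centre with the ball around an arbitrary point of the Cameron–Martin
space shows that the limit is a minimiser, and a minimiser is a MAP estimate because every sequence
of maximal balls accumulates at a point where the functional is not smaller. Maximal balls exist by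
weak upper semicontinuity, as spheres are null sets unless `C = 0`.

The statement on the conditional law reduces to this by Bayes' formula
(`IsPotential.condDistrib_ae_eq_bayesPosterior`).
-/

set_option linter.unusedSectionVars false

/-! ### Weak compactness and upper semicontinuity of ball probabilities -/

section Weak

variable {X : Type*} [NormedAddCommGroup X] [InnerProductSpace ℝ X]

/-- Weak convergence of a sequence in a Hilbert space, tested against all vectors. -/
def WeakTendsto (w : ℕ → X) (z : X) : Prop :=
  ∀ a : X, Tendsto (fun n => ⟪a, w n⟫) atTop (𝓝 ⟪a, z⟫)

lemma exists_subseq_weakTendsto [CompleteSpace X] [SecondCountableTopology X] {w : ℕ → X} {R : ℝ}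
    (hw : ∀ n, ‖w n‖ ≤ R) :
    ∃ (z : X) (k : ℕ → ℕ), StrictMono k ∧ WeakTendsto (fun n => w (k n)) z := by
  have hmem : ∀ n, (StrongDual.toWeakDual (InnerProductSpace.toDual ℝ X (w n)) : WeakDual ℝ X) ∈
      (WeakDual.toStrongDual (𝕜 := ℝ) (E := X)) ⁻¹' Metric.closedBall (0 : StrongDual ℝ X) R := by
    intro n
    simp only [Set.mem_preimage, mem_closedBall_zero_iff]
    exact ((InnerProductSpace.toDual ℝ X).norm_map (w n)).trans_le (hw n)
  obtain ⟨f, -, k, hk, hlim⟩ := WeakDual.isSeqCompact_closedBall ℝ X 0 R hmem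
  refine ⟨(InnerProductSpace.toDual ℝ X).symm (WeakDual.toStrongDual f), k, hk, fun a => ?_⟩
  have h1 := ((WeakDual.eval_continuous a).tendsto f).comp hlim
  have h2 : ⟪a, (InnerProductSpace.toDual ℝ X).symm (WeakDual.toStrongDual f)⟫ = f a := by
    rw [real_inner_comm, InnerProductSpace.toDual_symm_apply]; rfl
  rw [h2]
  refine h1.congr fun n => ?_
  change (InnerProductSpace.toDual ℝ X (w (k n))) a = _
  rw [InnerProductSpace.toDual_apply_apply, real_inner_comm]

/-- A point lying in infinitely many of the closed balls around a weakly convergent sequence lies in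
the closed ball around the weak limit. -/
lemma WeakTendsto.mem_closedBall {w : ℕ → X} {z x : X} (hw : WeakTendsto w z) {δ : ℝ}
    (hx : ∃ᶠ n in atTop, x ∈ Metric.closedBall (w n) δ) : x ∈ Metric.closedBall z δ := by
  rw [mem_closedBall_iff_norm]
  have hlim : Tendsto (fun n => ⟪x - z, x - w n⟫) atTop (𝓝 ⟪x - z, x - z⟫) := by
    simp only [inner_sub_right (x - z) x]
    exact tendsto_const_nhds.sub (hw (x - z))
  have hle : ⟪x - z, x - z⟫ ≤ ‖x - z‖ * δ := by
    refine le_of_tendsto_of_frequently hlim (hx.mono fun n hn => ?_)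
    rw [mem_closedBall_iff_norm] at hn
    exact (real_inner_le_norm _ _).trans (by gcongr)
  rw [real_inner_self_eq_norm_sq, sq] at hle
  rcases (norm_nonneg (x - z)).eq_or_lt with h0 | h0
  · obtain ⟨n, hn⟩ := hx.exists
    rw [mem_closedBall_iff_norm] at hn
    rw [← h0]; exact (norm_nonneg _).trans hn
  · exact le_of_mul_le_mul_left hle h0

/-- The weak upper semicontinuity of the measure of closed balls of a fixed radius. -/
lemma WeakTendsto.limsup_measure_closedBall_le [MeasurableSpace X] [OpensMeasurableSpace X]
    {w : ℕ → X} {z : X} (hw : WeakTendsto w z) (μ : Measure X) [IsFiniteMeasure μ] (δ : ℝ) :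
    limsup (fun n => μ (Metric.closedBall (w n) δ)) atTop ≤ μ (Metric.closedBall z δ) := by
  have hm : ∀ n, MeasurableSet (Metric.closedBall (w n) δ) := fun n =>
    Metric.isClosed_closedBall.measurableSet
  have h1 := limsup_lintegral_le (μ := μ) (fun _ => (1 : ℝ≥0∞))
    (f := fun n => (Metric.closedBall (w n) δ).indicator fun _ => (1 : ℝ≥0∞))
    (fun n => measurable_const.indicator (hm n))
    (fun n => ae_of_all _ fun x => Set.indicator_le_self' (fun _ _ => zero_le) x)
    (by simp)
  simp only [lintegral_indicator_const (hm _), one_mul] at h1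
  refine h1.trans ?_
  rw [← one_mul (μ (Metric.closedBall z δ)),
    ← lintegral_indicator_const Metric.isClosed_closedBall.measurableSet]
  refine lintegral_mono fun x => ?_
  by_cases hx : ∃ᶠ n in atTop, x ∈ Metric.closedBall (w n) δ
  · rw [Set.indicator_of_mem (hw.mem_closedBall hx)]
    refine limsup_le_of_le (by isBoundedDefault) (Eventually.of_forall fun n => ?_)
    exact Set.indicator_le_self' (fun _ _ => zero_le) x
  · rw [not_frequently] at hx
    refine limsup_le_of_le (by isBoundedDefault) ?_
    filter_upwards [hx] with n hn
    rw [Set.indicator_of_notMem hn]; exact zero_le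

/-- A weakly upper semicontinuous function which outside a ball is at most one of its values attains
its maximum. -/
lemma exists_forall_le_of_weak_usc [CompleteSpace X] [SecondCountableTopology X] {F : X → ℝ≥0∞}
    (husc : ∀ (w : ℕ → X) (z : X), WeakTendsto w z → limsup (fun n => F (w n)) atTop ≤ F z)
    {R : ℝ} {u : X} (hu : ∀ w, R < ‖w‖ → F w ≤ F u) : ∃ z, ∀ w, F w ≤ F z := by
  classical
  obtain ⟨s, -, hs, hsF⟩ := exists_seq_tendsto_sSup (Set.range_nonempty F) (OrderTop.bddAbove _)
  choose w hw using hsF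
  -- points outside the ball are replaced by `u`, which does not decrease the value of `F`
  set w' : ℕ → X := fun n => if R < ‖w n‖ then u else w n with hw'
  have hle : ∀ n, s n ≤ F (w' n) := by
    intro n
    rw [← hw n, hw']
    dsimp only
    split_ifs with h
    · exact hu _ h
    · exact le_rfl
  have hb : ∀ n, ‖w' n‖ ≤ max R ‖u‖ := by
    intro n
    rw [hw']
    dsimp only
    split_ifs with h
    · exact le_max_right _ _
    · exact (not_lt.mp h).trans (le_max_left _ _)
  obtain ⟨z, k, hk, hz⟩ := exists_subseq_weakTendsto hb
  refine ⟨z, fun v => (le_sSup (Set.mem_range_self v)).trans ?_⟩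
  refine le_trans ?_ (husc _ _ hz)
  rw [← (hs.comp hk.tendsto_atTop).limsup_eq]
  exact limsup_le_limsup (Eventually.of_forall fun n => hle (k n))

end Weak

section Balls

variable {X : Type*} [NormedAddCommGroup X] [MeasurableSpace X]

lemma exists_measure_ball_pos [SecondCountableTopology X] (μ : Measure X) [NeZero μ] {δ : ℝ}
    (hδ : 0 < δ) : ∃ u, 0 < μ (Metric.ball u δ) := by
  by_contra! h
  refine NeZero.ne μ (Measure.measure_univ_eq_zero.mp ?_)
  refine measure_null_of_locally_null _ fun x _ => ⟨Metric.ball x δ, ?_, nonpos_iff_eq_zero.mp (h x)⟩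
  exact mem_nhdsWithin_of_mem_nhds (Metric.ball_mem_nhds x hδ)

/-- The measure of balls of a fixed radius vanishes at infinity. -/
lemma exists_forall_measure_ball_le [OpensMeasurableSpace X] (μ : Measure X) [IsFiniteMeasure μ]
    {c : ℝ≥0∞} (hc : 0 < c) (δ : ℝ) : ∃ R : ℝ, ∀ w, R < ‖w‖ → μ (Metric.ball w δ) ≤ c := by
  have hlim : Tendsto (fun n : ℕ => μ (Metric.closedBall 0 n)ᶜ) atTop
      (𝓝 (μ (⋂ n : ℕ, (Metric.closedBall (0 : X) n)ᶜ))) := by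
    refine tendsto_measure_iInter_atTop
      (fun n => Metric.isClosed_closedBall.measurableSet.compl.nullMeasurableSet) ?_
      ⟨0, measure_ne_top _ _⟩
    intro m n hmn
    exact Set.compl_subset_compl.mpr (Metric.closedBall_subset_closedBall (by exact_mod_cast hmn))
  have h0 : (⋂ n : ℕ, (Metric.closedBall (0 : X) n)ᶜ) = ∅ := by
    rw [← Set.compl_iUnion, Metric.iUnion_closedBall_nat, Set.compl_univ]
  rw [h0, measure_empty] at hlim
  obtain ⟨n, hn⟩ := (hlim.eventually_lt_const hc).exists
  refine ⟨n + δ, fun w hw => (measure_mono fun x hx => ?_).trans hn.le⟩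
  rw [mem_ball_iff_norm] at hx
  rw [Set.mem_compl_iff, mem_closedBall_zero_iff, not_le]
  have := norm_sub_norm_le w x
  rw [norm_sub_rev] at this
  linarith

end Balls

/-! ### Shifts of Gaussian measures -/

section GaussianShift

variable {X : Type*} [NormedAddCommGroup X] [InnerProductSpace ℝ X] [CompleteSpace X]
  [SecondCountableTopology X] [MeasurableSpace X] [BorelSpace X]

/-- Probability measures on a Hilbert space with the same everywhere finite Laplace transform are
equal. -/
lemma ext_of_integral_exp_inner {μ ν : Measure X} [IsProbabilityMeasure μ] [IsProbabilityMeasure ν]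
    (hint : ∀ t : X, Integrable (fun x => Real.exp ⟪t, x⟫) μ)
    (heq : ∀ t : X, ∫ x, Real.exp ⟪t, x⟫ ∂μ = ∫ x, Real.exp ⟪t, x⟫ ∂ν) : μ = ν := by
  refine Measure.ext_of_charFun (funext fun t => ?_)
  have hmgf : mgf (fun x => ⟪t, x⟫) μ = mgf (fun x => ⟪t, x⟫) ν := by
    funext s
    simp only [mgf, ← real_inner_smul_left]
    exact heq (s • t)
  have huniv : integrableExpSet (fun x => ⟪t, x⟫) μ = Set.univ := by
    ext s
    simp only [integrableExpSet, Set.mem_ofPred_eq, Set.mem_univ, iff_true,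
      ← real_inner_smul_left]
    exact hint (s • t)
  have h := eqOn_complexMGF_of_mgf hmgf (x := Complex.I) (by simp [huniv])
  simp only [complexMGF] at h
  simp only [charFun_apply, real_inner_comm t, mul_comm _ Complex.I]
  exact h

namespace IsGaussianWith

variable {μ : Measure X} {m : X} {C : X →L[ℝ] X}

lemma inner_map_comm (h : IsGaussianWith μ m C) (u w : X) : ⟪C u, w⟫ = ⟪C w, u⟫ := by
  rw [h.covariance_eq, h.covariance_eq, covariance_comm]

lemma variance_inner (h : IsGaussianWith μ m C) (u : X) :
    Var[fun v => ⟪u, v⟫; μ] = ⟪C u, u⟫ := by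
  rw [h.covariance_eq, covariance_self (by fun_prop)]

lemma inner_map_self_nonneg (h : IsGaussianWith μ m C) (u : X) : 0 ≤ ⟪C u, u⟫ := by
  rw [← h.variance_inner]; exact variance_nonneg _ _

lemma integral_inner (h : IsGaussianWith μ m C) (u : X) : ∫ v, ⟪u, v⟫ ∂μ = ⟪u, m⟫ := by
  have := h.isGaussian
  rw [← h.mean_eq]
  exact IsGaussian.integral_dual (μ := μ) (innerSL ℝ u)

lemma memLp_inner (h : IsGaussianWith μ m C) (u : X) : MemLp (fun v => ⟪u, v⟫) 2 μ := by
  have := h.isGaussian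
  exact IsGaussian.memLp_dual μ (innerSL ℝ u) 2 (by norm_num)

lemma map_inner (h : IsGaussianWith μ m C) (u : X) :
    μ.map (fun v => ⟪u, v⟫) = gaussianReal ⟪u, m⟫ ⟪C u, u⟫.toNNReal := by
  have := h.isGaussian
  have h1 := IsGaussian.map_eq_gaussianReal (μ := μ) (innerSL ℝ u)
  have h2 : ((innerSL ℝ u : StrongDual ℝ X) : X → ℝ) = fun v => ⟪u, v⟫ := rfl
  rw [h2, h.integral_inner, h.variance_inner] at h1
  exact h1

lemma integrable_exp_inner (h : IsGaussianWith μ m C) (u : X) :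
    Integrable (fun v => Real.exp ⟪u, v⟫) μ := by
  have h1 := integrable_exp_mul_gaussianReal (μ := ⟪u, m⟫) (v := ⟪C u, u⟫.toNNReal) 1
  rw [← h.map_inner] at h1
  simpa [Function.comp_def] using h1.comp_measurable (f := fun v => ⟪u, v⟫) (by fun_prop)

lemma integral_exp_inner (h : IsGaussianWith μ m C) (u : X) :
    ∫ v, Real.exp ⟪u, v⟫ ∂μ = Real.exp (⟪u, m⟫ + ⟪C u, u⟫ / 2) := by
  have h1 := mgf_gaussianReal (h.map_inner u) 1
  simpa [mgf, Real.coe_toNNReal _ (h.inner_map_self_nonneg u)] using h1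

/-- The translate of a Gaussian measure that makes it centred. -/
lemma map_sub_mean (h : IsGaussianWith μ m C) :
    IsGaussianWith (μ.map fun x => x - m) 0 C := by
  have := h.isGaussian
  refine ⟨inferInstance, ?_, fun u w => ?_⟩
  · rw [integral_map (by fun_prop) (by fun_prop), integral_sub IsGaussian.integrable_fun_id
      (integrable_const _), h.mean_eq]
    simp
  · rw [covariance_map_fun (by fun_prop) (by fun_prop) (by fun_prop), h.covariance_eq]
    simp only [inner_sub_right]
    rw [covariance_sub_const_left, covariance_sub_const_right]
    · exact (h.memLp_inner w).integrable (by norm_num)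
    · exact (h.memLp_inner u).integrable (by norm_num)

variable {ν : Measure X}

lemma map_neg_eq (h : IsGaussianWith ν 0 C) : ν.map (fun x => -x) = ν := by
  have := h.isGaussian
  symm
  refine ext_of_integral_exp_inner h.integrable_exp_inner fun t => ?_
  rw [integral_map (by fun_prop) (by fun_prop)]
  simp only [inner_neg_right]
  simp only [← inner_neg_left, h.integral_exp_inner]
  simp

/-- The Cameron–Martin formula for shifts by vectors in the range of the covariance operator. -/
lemma map_add_range (h : IsGaussianWith ν 0 C) (a : X) :
    ν.map (fun x => x + C a) =
      ν.withDensity fun x => ENNReal.ofReal (Real.exp (⟪a, x⟫ - ⟪C a, a⟫ / 2)) := by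
  have := h.isGaussian
  have hint : Integrable (fun x => Real.exp (⟪a, x⟫ - ⟪C a, a⟫ / 2)) ν := by
    simp only [Real.exp_sub]
    exact (h.integrable_exp_inner a).div_const _
  have hprob : IsProbabilityMeasure
      (ν.withDensity fun x => ENNReal.ofReal (Real.exp (⟪a, x⟫ - ⟪C a, a⟫ / 2))) := by
    refine ⟨?_⟩
    rw [withDensity_apply _ .univ, Measure.restrict_univ]
    rw [← ofReal_integral_eq_lintegral_ofReal hint (ae_of_all _ fun x => (Real.exp_pos _).le)]
    simp only [Real.exp_sub]
    rw [integral_div, h.integral_exp_inner]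
    simp
  have hprob' : IsProbabilityMeasure (ν.map fun x => x + C a) :=
    Measure.isProbabilityMeasure_map (by fun_prop)
  refine ext_of_integral_exp_inner (fun t => ?_) fun t => ?_
  · rw [integrable_map_measure (by fun_prop) (by fun_prop)]
    simp only [Function.comp_def, inner_add_right, Real.exp_add]
    exact (h.integrable_exp_inner t).mul_const _
  · rw [integral_map (by fun_prop) (by fun_prop),
      integral_withDensity_eq_integral_toReal_smul (by fun_prop) (by simp)]
    have e1 : ∀ x : X, (ENNReal.ofReal (Real.exp (⟪a, x⟫ - ⟪C a, a⟫ / 2))).toReal • Real.exp ⟪t, x⟫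
        = Real.exp ⟪a + t, x⟫ * Real.exp (-(⟪C a, a⟫ / 2)) := by
      intro x
      rw [ENNReal.toReal_ofReal (Real.exp_pos _).le, smul_eq_mul, ← Real.exp_add, ← Real.exp_add,
        inner_add_left]
      ring_nf
    simp only [e1, inner_add_right t, Real.exp_add ⟪t, _⟫, integral_mul_const, h.integral_exp_inner]
    simp only [← Real.exp_add]
    have h1 := h.inner_map_comm a t
    have h2 := real_inner_comm t (C a)
    simp only [map_add, inner_add_left, inner_add_right, inner_zero_right]
    congr 1
    rw [h2]
    linarith

/-- The measure of a shifted set, as an integral over the set. -/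
lemma measure_preimage_add_range (h : IsGaussianWith ν 0 C) (a : X) {A : Set X}
    (hA : MeasurableSet A) :
    ν ((fun x => x + C a) ⁻¹' A) =
      ∫⁻ x in A, ENNReal.ofReal (Real.exp (⟪a, x⟫ - ⟪C a, a⟫ / 2)) ∂ν := by
  rw [← withDensity_apply _ hA, ← h.map_add_range, Measure.map_apply (by fun_prop) hA]

/-- If `-x ∈ A` whenever `x ∈ A` and `⟪a, x⟫ < 0`, then a shift of `A` by `-C a` decreases its
measure by at most a factor `exp (-⟪C a, a⟫ / 2)`: the contributions of `x` and `-x` to the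
Cameron–Martin density average to a hyperbolic cosine. -/
lemma exp_mul_measure_le_measure_preimage_add_range (h : IsGaussianWith ν 0 C) (a : X) {A : Set X}
    (hA : MeasurableSet A) (hneg : ∀ x ∈ A, ⟪a, x⟫ < 0 → -x ∈ A) :
    ENNReal.ofReal (Real.exp (-(⟪C a, a⟫ / 2))) * ν A ≤ ν ((fun x => x + C a) ⁻¹' A) := by
  have := h.isGaussian
  set f : X → ℝ≥0∞ := A.indicator fun x => ENNReal.ofReal (Real.exp ⟪a, x⟫) with hf
  set g : X → ℝ≥0∞ := A.indicator fun _ => 1 with hg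
  have hfm : Measurable f := Measurable.indicator (by fun_prop) hA
  have hgm : Measurable g := Measurable.indicator (by fun_prop) hA
  have hsymm : ∀ k : X → ℝ≥0∞, Measurable k → ∫⁻ x, k (-x) ∂ν = ∫⁻ x, k x ∂ν := by
    intro k hk
    conv_rhs => rw [← h.map_neg_eq, lintegral_map hk (by fun_prop)]
  have hpt : ∀ x, g x + g (-x) ≤ f x + f (-x) := by
    have hcosh : ∀ t : ℝ, (1 : ℝ≥0∞) + 1 ≤
        ENNReal.ofReal (Real.exp t) + ENNReal.ofReal (Real.exp (-t)) := by
      intro t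
      rw [← ENNReal.ofReal_one, ← ENNReal.ofReal_add (by norm_num) (by norm_num),
        ← ENNReal.ofReal_add (Real.exp_pos _).le (Real.exp_pos _).le]
      refine ENNReal.ofReal_le_ofReal ?_
      have h1 := Real.add_one_le_exp t
      have h2 := Real.add_one_le_exp (-t)
      linarith
    have hone : ∀ t : ℝ, 0 ≤ t → (1 : ℝ≥0∞) ≤ ENNReal.ofReal (Real.exp t) := by
      intro t ht
      rw [ENNReal.one_le_ofReal]
      exact Real.one_le_exp ht
    intro x
    by_cases h1 : x ∈ A <;> by_cases h2 : -x ∈ A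
    · simpa [hf, hg, h1, h2] using hcosh ⟪a, x⟫
    · have h3 : 0 ≤ ⟪a, x⟫ := not_lt.mp fun h4 => h2 (hneg x h1 h4)
      simpa [hf, hg, h1, h2] using hone _ h3
    · have h3 : 0 ≤ ⟪a, -x⟫ := not_lt.mp fun h4 => h1 (by simpa using hneg (-x) h2 h4)
      rw [inner_neg_right] at h3
      simpa [hf, hg, h1, h2] using hone _ h3
    · simp [hf, hg, h1, h2]
  have hle : ν A ≤ ∫⁻ x in A, ENNReal.ofReal (Real.exp ⟪a, x⟫) ∂ν := by
    have h1 := lintegral_mono (μ := ν) hpt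
    rw [lintegral_add_left hgm, lintegral_add_left hfm, hsymm _ hfm, hsymm _ hgm, ← two_mul,
      ← two_mul, ENNReal.mul_le_mul_iff_right (by norm_num) (by norm_num)] at h1
    rwa [hg, hf, lintegral_indicator_const hA, one_mul, lintegral_indicator hA] at h1
  rw [h.measure_preimage_add_range a hA]
  simp only [sub_eq_neg_add, Real.exp_add, ENNReal.ofReal_mul (Real.exp_pos _).le]
  rw [lintegral_const_mul _ (by fun_prop)]
  gcongr

end IsGaussianWith

end GaussianShift

/-! ### Small balls of a centred Gaussian measure -/

section SmallBalls

variable {X : Type*} [NormedAddCommGroup X] [InnerProductSpace ℝ X]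

/-- A bound for all smaller concentric balls passes to an open ball. -/
lemma le_measure_ball_of_forall_lt [MeasurableSpace X] {μ : Measure X} {w : X} {δ : ℝ} {c : ℝ≥0∞}
    (h : ∀ r < δ, μ (Metric.ball w r) ≤ c) : μ (Metric.ball w δ) ≤ c := by
  obtain ⟨r, hr, hrδ, hlim⟩ := exists_seq_strictMono_tendsto δ
  have hU : Metric.ball w δ = ⋃ n, Metric.ball w (r n) := by
    ext x
    simp only [Metric.mem_ball, Set.mem_iUnion]
    exact ⟨fun hx => (hlim.eventually_const_lt hx).exists, fun ⟨n, hn⟩ => hn.trans (hrδ n)⟩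
  have hmono : Monotone fun n => Metric.ball w (r n) :=
    fun i j hij => Metric.ball_subset_ball (hr.monotone hij)
  rw [hU, hmono.measure_iUnion]
  exact iSup_le fun n => h _ (hrδ n)

variable [CompleteSpace X] [SecondCountableTopology X] [MeasurableSpace X] [BorelSpace X]

lemma WeakTendsto.limsup_ofReal_exp_neg_norm_sq_le {w : ℕ → X} {z : X} (hw : WeakTendsto w z)
    {κ : ℝ} (hκ : 0 ≤ κ) :
    limsup (fun n => ENNReal.ofReal (Real.exp (-(κ * ‖w n‖ ^ 2)))) atTop ≤
      ENNReal.ofReal (Real.exp (-(κ * ‖z‖ ^ 2))) := by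
  have hlim : Tendsto (fun n => ENNReal.ofReal (Real.exp (-(κ * (2 * ⟪z, w n⟫ - ‖z‖ ^ 2))))) atTop
      (𝓝 (ENNReal.ofReal (Real.exp (-(κ * (2 * ⟪z, z⟫ - ‖z‖ ^ 2)))))) := by
    refine ENNReal.tendsto_ofReal ((Real.continuous_exp.tendsto _).comp ?_)
    exact ((((hw z).const_mul 2).sub_const _).const_mul κ).neg
  rw [real_inner_self_eq_norm_sq, two_mul, add_sub_cancel_right] at hlim
  rw [← hlim.limsup_eq]
  refine limsup_le_limsup (Eventually.of_forall fun n => ENNReal.ofReal_le_ofReal ?_)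
  rw [Real.exp_le_exp, neg_le_neg_iff]
  refine mul_le_mul_of_nonneg_left ?_ hκ
  have h := norm_sub_sq_real z (w n)
  nlinarith [sq_nonneg ‖z - w n‖]

namespace IsGaussianWith

variable {ν : Measure X} {C : X →L[ℝ] X}

/-- Moving the centre `w` of a ball to `w - t • C w` decreases its measure only to second order in
`t`: whenever `⟪w, x⟫ < 0` for a point `x` of the ball, the ball also contains `-x`. -/
lemma exp_mul_measure_closedBall_le (h : IsGaussianWith ν 0 C) (w : X) (δ : ℝ) {t : ℝ}
    (ht : 0 < t) :
    ENNReal.ofReal (Real.exp (-(t ^ 2 * ⟪C w, w⟫ / 2))) * ν (Metric.closedBall w δ) ≤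
      ν (Metric.closedBall (w - t • C w) δ) := by
  have h1 := h.exp_mul_measure_le_measure_preimage_add_range (t • w)
    (A := Metric.closedBall w δ) Metric.isClosed_closedBall.measurableSet ?_
  · have e1 : ⟪C (t • w), t • w⟫ = t ^ 2 * ⟪C w, w⟫ := by
      rw [map_smul, real_inner_smul_left, real_inner_smul_right]; ring
    have e2 : (fun x => x + C (t • w)) ⁻¹' Metric.closedBall w δ =
        Metric.closedBall (w - t • C w) δ := by
      ext x
      simp only [Set.mem_preimage, mem_closedBall_iff_norm, map_smul]
      rw [show x + t • C w - w = x - (w - t • C w) by abel]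
    rwa [e1, e2] at h1
  · intro x hx hneg
    rw [real_inner_smul_left] at hneg
    have hneg' : ⟪w, x⟫ < 0 := by
      by_contra hc
      exact absurd hneg (not_lt.mpr (mul_nonneg ht.le (not_lt.mp hc)))
    rw [mem_closedBall_iff_norm] at hx ⊢
    refine le_trans ?_ hx
    rw [← neg_add', norm_neg]
    refine le_of_sq_le_sq ?_ (norm_nonneg _)
    rw [norm_add_sq_real, norm_sub_sq_real, real_inner_comm]
    linarith

/-- Moving a ball along the kernel of the covariance does not increase its measure. -/
lemma measure_closedBall_le_of_inner_map_self_eq_zero (h : IsGaussianWith ν 0 C) {w : X}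
    (hw : ⟪C w, w⟫ = 0) (δ : ℝ) :
    ν (Metric.closedBall w δ) ≤ ν (Metric.closedBall 0 δ) := by
  have := h.isGaussian
  have hae := ae_eq_integral_of_variance_eq_zero (h.memLp_inner w) (by rw [h.variance_inner, hw])
  simp only [h.integral_inner, inner_zero_right] at hae
  refine measure_mono_ae ?_
  filter_upwards [hae] with x hx
  intro hxw
  replace hxw : x ∈ Metric.closedBall w δ := hxw
  change x ∈ Metric.closedBall 0 δ
  rw [mem_closedBall_iff_norm] at hxw
  rw [mem_closedBall_zero_iff]
  refine le_trans (le_of_sq_le_sq ?_ (norm_nonneg _)) hxw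
  rw [norm_sub_sq_real, real_inner_comm, hx]
  nlinarith [sq_nonneg ‖w‖]

/-- Anderson's inequality for closed balls up to a Gaussian factor in the centre. As a function of
`w`, the left-hand side attains its maximum at some `z`, and comparing its values at `z` and
`z - t • C z` for small `t` shows `⟪C z, z⟫ = 0`. -/
lemma exp_mul_measure_closedBall_le_measure_closedBall_zero (h : IsGaussianWith ν 0 C) {κ : ℝ}
    (hκ : 0 < κ) {δ : ℝ} (hδ : 0 < δ) (w : X) :
    ENNReal.ofReal (Real.exp (-(κ * ‖w‖ ^ 2))) * ν (Metric.closedBall w δ) ≤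
      ν (Metric.closedBall 0 δ) := by
  have := h.isGaussian
  set G : X → ℝ≥0∞ := fun w =>
    ENNReal.ofReal (Real.exp (-(κ * ‖w‖ ^ 2))) * ν (Metric.closedBall w δ) with hG
  have hGpos : ∀ w, 0 < ν (Metric.closedBall w δ) → 0 < G w := fun w hw =>
    ENNReal.mul_pos (by simpa using Real.exp_pos _) hw.ne'
  obtain ⟨u, hu⟩ := exists_measure_ball_pos ν hδ
  have hu' : 0 < G u := hGpos u (hu.trans_le (measure_mono Metric.ball_subset_closedBall))
  obtain ⟨R, hR⟩ := exists_forall_measure_ball_le ν hu' (δ + 1)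
  obtain ⟨z, hz⟩ : ∃ z, ∀ w, G w ≤ G z := by
    refine exists_forall_le_of_weak_usc (R := R) (u := u) (fun w z hwz => ?_) fun w hw => ?_
    · refine (ENNReal.limsup_mul_le' (Or.inr ?_) (Or.inl ?_)).trans ?_
      · exact ne_top_of_le_ne_top (measure_ne_top ν _) (hwz.limsup_measure_closedBall_le ν δ)
      · exact ne_top_of_le_ne_top ENNReal.ofReal_ne_top
          (hwz.limsup_ofReal_exp_neg_norm_sq_le hκ.le)
      · exact mul_le_mul' (hwz.limsup_ofReal_exp_neg_norm_sq_le hκ.le)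
          (hwz.limsup_measure_closedBall_le ν δ)
    · refine le_trans ?_ (hR w hw)
      refine (mul_le_of_le_one_left zero_le ?_).trans
        (measure_mono (Metric.closedBall_subset_ball (by linarith)))
      rw [ENNReal.ofReal_le_one, Real.exp_le_one_iff]
      have := mul_nonneg hκ.le (sq_nonneg ‖w‖)
      linarith
  have hzpos : 0 < ν (Metric.closedBall z δ) := by
    by_contra hc
    have h0 : G z = 0 := by simp [hG, nonpos_iff_eq_zero.mp (not_lt.mp hc)]
    exact absurd (hz u) (not_le.mpr (by rwa [h0]))
  set q := ⟪C z, z⟫ with hq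
  have hkey : ∀ t : ℝ, 0 < t → 2 * κ * q ≤ t * (q / 2 + κ * ‖C z‖ ^ 2) := by
    intro t ht
    have h1 := (mul_le_mul_right (h.exp_mul_measure_closedBall_le z δ ht)
      (ENNReal.ofReal (Real.exp (-(κ * ‖z - t • C z‖ ^ 2))))).trans (hz (z - t • C z))
    rw [← mul_assoc, hG, ENNReal.mul_le_mul_iff_left hzpos.ne' (measure_ne_top _ _),
      ← ENNReal.ofReal_mul (Real.exp_pos _).le, ← Real.exp_add,
      ENNReal.ofReal_le_ofReal_iff (Real.exp_pos _).le, Real.exp_le_exp] at h1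
    have h2 : ‖z - t • C z‖ ^ 2 = ‖z‖ ^ 2 - 2 * (t * q) + t ^ 2 * ‖C z‖ ^ 2 := by
      rw [norm_sub_sq_real, real_inner_smul_right, norm_smul, mul_pow, real_inner_comm,
        Real.norm_eq_abs, sq_abs]
    rw [h2] at h1
    refine le_of_mul_le_mul_left ?_ ht
    nlinarith
  have hq0 : q = 0 := by
    refine le_antisymm ?_ (h.inner_map_self_nonneg z)
    have hlim : Tendsto (fun t : ℝ => t * (q / 2 + κ * ‖C z‖ ^ 2)) (𝓝[>] 0) (𝓝 0) := by
      have : Tendsto (fun t : ℝ => t * (q / 2 + κ * ‖C z‖ ^ 2)) (𝓝 0)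
          (𝓝 (0 * (q / 2 + κ * ‖C z‖ ^ 2))) := tendsto_id.mul_const _
      rw [zero_mul] at this
      exact this.mono_left nhdsWithin_le_nhds
    have h1 : 2 * κ * q ≤ 0 := ge_of_tendsto hlim (eventually_mem_nhdsWithin.mono hkey)
    nlinarith
  refine (hz w).trans (le_trans ?_ (h.measure_closedBall_le_of_inner_map_self_eq_zero hq0 δ))
  refine mul_le_of_le_one_left zero_le ?_
  rw [ENNReal.ofReal_le_one, Real.exp_le_one_iff]
  have := mul_nonneg hκ.le (sq_nonneg ‖z‖)
  linarith

/-- Anderson's inequality for balls: among all balls of a given radius, the one around the mean has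
maximal measure. -/
lemma measure_ball_le_measure_ball_zero (h : IsGaussianWith ν 0 C) (w : X) (δ : ℝ) :
    ν (Metric.ball w δ) ≤ ν (Metric.ball 0 δ) := by
  have := h.isGaussian
  refine le_measure_ball_of_forall_lt fun r hr => ?_
  rcases le_or_gt r 0 with hr0 | hr0
  · simp [Metric.ball_eq_empty.mpr hr0]
  refine le_trans ?_ (measure_mono (Metric.closedBall_subset_ball hr))
  refine (measure_mono Metric.ball_subset_closedBall).trans ?_
  have hlim : Tendsto (fun κ : ℝ => ENNReal.ofReal (Real.exp (-(κ * ‖w‖ ^ 2))) *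
      ν (Metric.closedBall w r)) (𝓝[>] 0) (𝓝 (ν (Metric.closedBall w r))) := by
    have hc : Continuous fun κ : ℝ => ENNReal.ofReal (Real.exp (-(κ * ‖w‖ ^ 2))) :=
      ENNReal.continuous_ofReal.comp (by fun_prop)
    have h0 := (hc.tendsto 0).mono_left (nhdsWithin_le_nhds (s := Set.Ioi 0))
    have h1 := ENNReal.Tendsto.mul_const h0 (Or.inr (measure_ne_top ν (Metric.closedBall w r)))
    simpa using h1
  exact le_of_tendsto hlim (eventually_mem_nhdsWithin.mono fun κ hκ =>
    h.exp_mul_measure_closedBall_le_measure_closedBall_zero hκ hr0 w)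

lemma measure_ball_zero_pos (h : IsGaussianWith ν 0 C) {δ : ℝ} (hδ : 0 < δ) :
    0 < ν (Metric.ball 0 δ) := by
  have := h.isGaussian
  obtain ⟨u, hu⟩ := exists_measure_ball_pos ν hδ
  exact hu.trans_le (h.measure_ball_le_measure_ball_zero u δ)

/-- The upper bound for the measure of small balls: a shift of the ball by `-C a` changes the measure
according to the Cameron–Martin formula, and the shifted ball has at most the measure of the ball
around the mean. -/
lemma measure_ball_le_exp_mul (h : IsGaussianWith ν 0 C) (w a : X) (δ : ℝ) :
    ν (Metric.ball w δ) ≤ ENNReal.ofReal (Real.exp (-(⟪a, w⟫ - ⟪C a, a⟫ / 2) + δ * ‖a‖)) *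
      ν (Metric.ball 0 δ) := by
  set s := ⟪a, w⟫ - ⟪C a, a⟫ / 2 - δ * ‖a‖ with hs
  have h1 : ENNReal.ofReal (Real.exp s) * ν (Metric.ball w δ) ≤ ν (Metric.ball 0 δ) := by
    refine le_trans ?_ (h.measure_ball_le_measure_ball_zero (w - C a) δ)
    rw [← Metric.preimage_add_right_ball,
      h.measure_preimage_add_range a Metric.isOpen_ball.measurableSet, ← setLIntegral_const]
    refine setLIntegral_mono' Metric.isOpen_ball.measurableSet fun x hx => ?_
    refine ENNReal.ofReal_le_ofReal (Real.exp_le_exp.mpr ?_)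
    rw [mem_ball_iff_norm'] at hx
    have h2 : ⟪a, w - x⟫ ≤ ‖a‖ * δ := (real_inner_le_norm _ _).trans (by gcongr)
    rw [inner_sub_right] at h2
    rw [hs]
    linarith
  have h2 : -(⟪a, w⟫ - ⟪C a, a⟫ / 2) + δ * ‖a‖ = -s := by rw [hs]; ring
  calc ν (Metric.ball w δ)
      = ENNReal.ofReal (Real.exp (-s)) * (ENNReal.ofReal (Real.exp s) * ν (Metric.ball w δ)) := by
        rw [← mul_assoc, ← ENNReal.ofReal_mul (Real.exp_pos _).le, ← Real.exp_add]
        simp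
    _ ≤ _ := by rw [h2]; gcongr

lemma exp_mul_measure_ball_zero_le_range (h : IsGaussianWith ν 0 C) (a : X) (δ : ℝ) :
    ENNReal.ofReal (Real.exp (-(⟪C a, a⟫ / 2))) * ν (Metric.ball 0 δ) ≤
      ν (Metric.ball (C a) δ) := by
  have h1 := h.exp_mul_measure_le_measure_preimage_add_range (-a) (A := Metric.ball 0 δ)
    Metric.isOpen_ball.measurableSet fun x hx _ => by simpa using hx
  rw [Metric.preimage_add_right_ball] at h1
  simpa using h1

/-- Tikhonov regularisation: a vector `w` with `⟪a, w⟫ - ⟪C a, a⟫ / 2 ≤ K` for all `a` is a limit of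
vectors `C a` with `⟪C a, a⟫ / 2 ≤ K`, namely those with `C a + t • a = w` for small `t`. -/
lemma exists_map_near (h : IsGaussianWith ν 0 C) {w : X} {K : ℝ}
    (hw : ∀ a, ⟪a, w⟫ - ⟪C a, a⟫ / 2 ≤ K) {r : ℝ} (hr : 0 < r) :
    ∃ a, ‖w - C a‖ < r ∧ ⟪C a, a⟫ / 2 ≤ K := by
  have hK : 0 ≤ K := by simpa using hw 0
  set t : ℝ := r ^ 2 / (K + 1) with ht
  have htpos : 0 < t := by positivity
  set B : X →L[ℝ] X →L[ℝ] ℝ := (innerSL ℝ).comp (C + t • ContinuousLinearMap.id ℝ X) with hB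
  have hBapp : ∀ a b, B a b = ⟪C a, b⟫ + t * ⟪a, b⟫ := by
    intro a b
    change ⟪C a + t • a, b⟫ = _
    rw [inner_add_left, real_inner_smul_left]
  have hcoer : IsCoercive B := by
    refine ⟨t, htpos, fun u => ?_⟩
    rw [hBapp, real_inner_self_eq_norm_sq]
    nlinarith [h.inner_map_self_nonneg u]
  set a := hcoer.continuousLinearEquivOfBilin.symm w with ha
  have hsol : w = C a + t • a := by
    refine ext_inner_right ℝ fun b => ?_
    have h1 := hcoer.continuousLinearEquivOfBilin_apply a b
    rw [ha, ContinuousLinearEquiv.apply_symm_apply, ← ha, hBapp] at h1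
    rw [h1, inner_add_left, real_inner_smul_left]
  have h1 := hw a
  have hin : ⟪a, w⟫ = ⟪C a, a⟫ + t * ‖a‖ ^ 2 := by
    rw [hsol, inner_add_right, real_inner_smul_right, real_inner_self_eq_norm_sq, real_inner_comm]
  have h2 := h.inner_map_self_nonneg a
  have h3 : 0 ≤ t * ‖a‖ ^ 2 := by positivity
  refine ⟨a, ?_, by linarith⟩
  have h4 : w - C a = t • a := by rw [hsol]; abel
  rw [h4, norm_smul, Real.norm_of_nonneg htpos.le]
  refine lt_of_pow_lt_pow_left₀ 2 hr.le ?_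
  have h5 : t * ‖a‖ ^ 2 ≤ K := by linarith
  calc (t * ‖a‖) ^ 2 = t * (t * ‖a‖ ^ 2) := by ring
    _ ≤ t * K := by gcongr
    _ < t * (K + 1) := by gcongr; linarith
    _ = r ^ 2 := by rw [ht]; field_simp

/-- The lower bound for the measure of small balls around points of the Cameron–Martin space. -/
lemma exp_mul_measure_ball_zero_le (h : IsGaussianWith ν 0 C) {w : X} {K : ℝ}
    (hw : ∀ a, ⟪a, w⟫ - ⟪C a, a⟫ / 2 ≤ K) (δ : ℝ) :
    ENNReal.ofReal (Real.exp (-K)) * ν (Metric.ball 0 δ) ≤ ν (Metric.ball w δ) := by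
  have hc : ENNReal.ofReal (Real.exp (-K)) ≠ 0 := by simpa using Real.exp_pos _
  rw [mul_comm, ← ENNReal.le_div_iff_mul_le (Or.inl hc) (Or.inl ENNReal.ofReal_ne_top)]
  refine le_measure_ball_of_forall_lt fun r hr => ?_
  rw [ENNReal.le_div_iff_mul_le (Or.inl hc) (Or.inl ENNReal.ofReal_ne_top), mul_comm]
  obtain ⟨a, ha, haK⟩ := h.exists_map_near hw (sub_pos.mpr hr)
  calc ENNReal.ofReal (Real.exp (-K)) * ν (Metric.ball 0 r)
      ≤ ENNReal.ofReal (Real.exp (-(⟪C a, a⟫ / 2))) * ν (Metric.ball 0 r) := by gcongr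
    _ ≤ ν (Metric.ball (C a) r) := h.exp_mul_measure_ball_zero_le_range a r
    _ ≤ ν (Metric.ball w δ) := by
        refine measure_mono (Metric.ball_subset_ball' ?_)
        rw [dist_eq_norm, norm_sub_rev]
        linarith

/-- The covariance form of a Gaussian measure tends to zero along weakly null sequences; this is the
compactness of the covariance operator. -/
lemma tendsto_inner_map_self_of_weakTendsto_zero (h : IsGaussianWith ν 0 C) {a : ℕ → X} {R : ℝ}
    (hR : ∀ n, ‖a n‖ ≤ R) (ha : WeakTendsto a 0) :
    Tendsto (fun n => ⟪C (a n), a n⟫) atTop (𝓝 0) := by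
  have := h.isGaussian
  have hvar : ∀ u, ⟪C u, u⟫ = ∫ x, ⟪u, x⟫ ^ 2 ∂ν := by
    intro u
    rw [← h.variance_inner, variance_of_integral_eq_zero (by fun_prop)]
    rw [h.integral_inner, inner_zero_right]
  simp only [hvar]
  have hint : Integrable (fun x : X => R ^ 2 * ‖x‖ ^ 2) ν :=
    ((IsGaussian.memLp_two_fun_id (μ := ν)).norm.integrable_sq).const_mul _
  have hlim := tendsto_integral_of_dominated_convergence (μ := ν)
    (F := fun n x => ⟪a n, x⟫ ^ 2) (f := fun _ => (0 : ℝ)) _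
    (fun n => by fun_prop) hint (fun n => ae_of_all _ fun x => ?_) (ae_of_all _ fun x => ?_)
  · simpa using hlim
  · rw [Real.norm_of_nonneg (sq_nonneg _), ← mul_pow, ← sq_abs]
    refine pow_le_pow_left₀ (abs_nonneg _) ((abs_real_inner_le_norm _ _).trans ?_) 2
    gcongr
    exact hR n
  · have h1 := (ha x).pow 2
    simpa [real_inner_comm] using h1

/-- Spheres are null sets of a nondegenerate Gaussian measure: a line in the direction `C a` meets a
sphere in at most two points, so almost every translate of the sphere along this direction is null,
and the Gaussian measure is quasi-invariant under these translations. -/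
lemma measure_sphere_eq_zero (h : IsGaussianWith ν 0 C) (hC : C ≠ 0) (w : X) (δ : ℝ) :
    ν (Metric.sphere w δ) = 0 := by
  have := h.isGaussian
  obtain ⟨a, ha⟩ : ∃ a, C a ≠ 0 := by
    by_contra! hc
    exact hC (ContinuousLinearMap.ext hc)
  set b := C a with hb
  have hS : MeasurableSet (Metric.sphere w δ) := Metric.isClosed_sphere.measurableSet
  have hquad : ∀ x : X, (volume : Measure ℝ) {t : ℝ | x + t • b ∈ Metric.sphere w δ} = 0 := by
    intro x
    have hbpos : 0 < ‖b‖ ^ 2 := by positivity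
    set p : Polynomial ℝ := Polynomial.C (‖b‖ ^ 2) * Polynomial.X ^ 2 +
      Polynomial.C (2 * ⟪x - w, b⟫) * Polynomial.X + Polynomial.C (‖x - w‖ ^ 2 - δ ^ 2) with hp
    have hp0 : p ≠ 0 := by
      intro h0
      have hdeg := Polynomial.degree_quadratic (b := 2 * ⟪x - w, b⟫) (c := ‖x - w‖ ^ 2 - δ ^ 2)
        hbpos.ne'
      rw [← hp, h0] at hdeg
      simp at hdeg
    refine Set.Finite.measure_zero ((p.rootSet_finite ℝ).subset fun t ht => ?_) _
    rw [Polynomial.mem_rootSet]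
    refine ⟨hp0, ?_⟩
    rw [Set.mem_ofPred_eq, mem_sphere_iff_norm] at ht
    have h1 : ‖x + t • b - w‖ ^ 2 = δ ^ 2 := by rw [ht]
    rw [show x + t • b - w = (x - w) + t • b by abel, norm_add_sq_real, real_inner_smul_right,
      norm_smul, mul_pow, Real.norm_eq_abs, sq_abs] at h1
    simp [hp]
    linarith
  have hmeas : MeasurableSet {p : ℝ × X | p.2 + p.1 • b ∈ Metric.sphere w δ} :=
    (by fun_prop : Measurable fun p : ℝ × X => p.2 + p.1 • b) hS
  have hnull : ((volume : Measure ℝ).prod ν) {p : ℝ × X | p.2 + p.1 • b ∈ Metric.sphere w δ} = 0 := by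
    rw [Measure.prod_apply_symm hmeas]
    exact lintegral_eq_zero_of_ae_eq_zero (ae_of_all ν hquad)
  have hae := Measure.measure_ae_null_of_prod_null hnull
  obtain ⟨t, ht⟩ := hae.exists
  replace ht : ν ((fun x => x + C (t • a)) ⁻¹' Metric.sphere w δ) = 0 := by
    rw [map_smul]; exact ht
  rw [h.measure_preimage_add_range (t • a) hS, setLIntegral_eq_zero_iff hS (by fun_prop)] at ht
  refine measure_mono_null ?_ (ae_iff.mp ht)
  intro x hx
  simp only [Set.mem_ofPred_eq, Classical.not_imp, ENNReal.ofReal_eq_zero, not_le]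
  exact ⟨hx, Real.exp_pos _⟩

end IsGaussianWith

end SmallBalls

/-! ### The Cameron–Martin norm and small balls around arbitrary means -/

section CameronMartinNorm

variable {X : Type*} [NormedAddCommGroup X] [InnerProductSpace ℝ X] [CompleteSpace X]
  [SecondCountableTopology X] [MeasurableSpace X] [BorelSpace X]

lemma measure_ball_eq_map_sub (μ : Measure X) (m z : X) (δ : ℝ) :
    μ (Metric.ball z δ) = μ.map (fun x => x - m) (Metric.ball (z - m) δ) := by
  rw [Measure.map_apply (by fun_prop) Metric.isOpen_ball.measurableSet]
  congr 1
  ext x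
  simp

namespace IsGaussianWith

variable {μ : Measure X} {m : X} {C : X →L[ℝ] X}

lemma cameronMartinNorm_le (h : IsGaussianWith μ m C) {w : X} {K : ℝ}
    (hw : ∀ a, ⟪a, w⟫ - ⟪C a, a⟫ / 2 ≤ K) :
    cameronMartinNorm μ w ≤ ENNReal.ofReal (Real.sqrt (2 * K)) := by
  refine iSup₂_le fun L hL => ENNReal.ofReal_le_ofReal ?_
  set a := (InnerProductSpace.toDual ℝ X).symm L with ha
  have hLa : ∀ x, L x = ⟪a, x⟫ := fun x => by rw [ha, InnerProductSpace.toDual_symm_apply]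
  simp only [hLa] at hL ⊢
  rw [h.variance_inner] at hL
  refine Real.le_sqrt_of_sq_le ?_
  -- the multiple `⟪a, w⟫ • a` is the optimal choice when `⟪C a, a⟫ = 1`
  have h1 := hw (⟪a, w⟫ • a)
  rw [map_smul, real_inner_smul_left, real_inner_smul_left, real_inner_smul_right] at h1
  nlinarith [mul_le_mul_of_nonneg_left hL (sq_nonneg ⟪a, w⟫)]

lemma mem_cameronMartinSpace (h : IsGaussianWith μ m C) {w : X} {K : ℝ}
    (hw : ∀ a, ⟪a, w⟫ - ⟪C a, a⟫ / 2 ≤ K) : w ∈ cameronMartinSpace μ :=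
  (h.cameronMartinNorm_le hw).trans_lt ENNReal.ofReal_lt_top

/-- Half the squared Cameron–Martin norm is the Legendre transform of half the covariance form. -/
lemma isLUB_cameronMartinNorm (h : IsGaussianWith μ m C) {w : X}
    (hw : w ∈ cameronMartinSpace μ) :
    IsLUB (Set.range fun a => ⟪a, w⟫ - ⟪C a, a⟫ / 2)
      (1 / 2 * (cameronMartinNorm μ w).toReal ^ 2) := by
  set r := (cameronMartinNorm μ w).toReal with hr
  have hr0 : 0 ≤ r := ENNReal.toReal_nonneg
  have hunit : ∀ a, ⟪C a, a⟫ ≤ 1 → ⟪a, w⟫ ≤ r := by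
    intro a ha
    have h1 : ENNReal.ofReal (innerSL ℝ a w) ≤ cameronMartinNorm μ w := by
      refine le_iSup₂_of_le (f := fun (L : StrongDual ℝ X) (_ : Var[fun u => L u; μ] ≤ 1) =>
        ENNReal.ofReal (L w)) (innerSL ℝ a) ?_ le_rfl
      exact (h.variance_inner a).le.trans ha
    exact (ENNReal.ofReal_le_iff_le_toReal hw.ne).mp h1
  constructor
  · rintro _ ⟨a, rfl⟩
    refine le_of_forall_pos_le_add fun ε hε => ?_
    have hq := h.inner_map_self_nonneg a
    set s := Real.sqrt (⟪C a, a⟫ + 2 * ε) with hs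
    have hs2 : s ^ 2 = ⟪C a, a⟫ + 2 * ε := Real.sq_sqrt (by positivity)
    have hspos : 0 < s := Real.sqrt_pos.mpr (by positivity)
    have h1 := hunit (s⁻¹ • a) (by
      rw [map_smul, real_inner_smul_left, real_inner_smul_right, ← mul_assoc, ← sq, inv_pow,
        inv_mul_le_one₀ (by positivity), hs2]
      linarith)
    rw [real_inner_smul_left, inv_mul_le_iff₀ hspos] at h1
    dsimp only
    nlinarith [sq_nonneg (s - r)]
  · intro K hK
    have hK' : ∀ a, ⟪a, w⟫ - ⟪C a, a⟫ / 2 ≤ K := fun a => hK ⟨a, rfl⟩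
    have hK0 : 0 ≤ K := by simpa using hK' 0
    have h1 : r ≤ Real.sqrt (2 * K) :=
      ENNReal.toReal_le_of_le_ofReal (Real.sqrt_nonneg _) (h.cameronMartinNorm_le hK')
    have h2 : r ^ 2 ≤ 2 * K := by
      rw [← Real.sq_sqrt (show 0 ≤ 2 * K by positivity)]
      gcongr
    linarith

lemma measure_ball_mean_pos (h : IsGaussianWith μ m C) {δ : ℝ} (hδ : 0 < δ) :
    0 < μ (Metric.ball m δ) := by
  rw [measure_ball_eq_map_sub μ m, sub_self]
  exact h.map_sub_mean.measure_ball_zero_pos hδ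

lemma measure_ball_le_exp_mul_mean (h : IsGaussianWith μ m C) (z a : X) (δ : ℝ) :
    μ (Metric.ball z δ) ≤ ENNReal.ofReal (Real.exp (-(⟪a, z - m⟫ - ⟪C a, a⟫ / 2) + δ * ‖a‖)) *
      μ (Metric.ball m δ) := by
  rw [measure_ball_eq_map_sub μ m, measure_ball_eq_map_sub μ m m, sub_self]
  exact h.map_sub_mean.measure_ball_le_exp_mul _ _ _

lemma exp_mul_measure_ball_mean_le (h : IsGaussianWith μ m C) {z : X} {K : ℝ}
    (hz : ∀ a, ⟪a, z - m⟫ - ⟪C a, a⟫ / 2 ≤ K) (δ : ℝ) :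
    ENNReal.ofReal (Real.exp (-K)) * μ (Metric.ball m δ) ≤ μ (Metric.ball z δ) := by
  rw [measure_ball_eq_map_sub μ m, measure_ball_eq_map_sub μ m z, sub_self]
  exact h.map_sub_mean.exp_mul_measure_ball_zero_le hz _

lemma measure_sphere_eq_zero_of_ne (h : IsGaussianWith μ m C) (hC : C ≠ 0) (w : X) (δ : ℝ) :
    μ (Metric.sphere w δ) = 0 := by
  rw [← h.map_sub_mean.measure_sphere_eq_zero hC (w - m) δ,
    Measure.map_apply (by fun_prop) Metric.isClosed_sphere.measurableSet]
  congr 1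
  ext x
  simp [mem_sphere_iff_norm]

lemma eq_dirac_of_eq_zero (h : IsGaussianWith μ m C) (hC : C = 0) : μ = Measure.dirac m := by
  have := h.isGaussian
  rw [← h.mean_eq]
  refine IsGaussian.eq_dirac_of_variance_eq_zero fun L => ?_
  have h1 := h.variance_inner ((InnerProductSpace.toDual ℝ X).symm L)
  simp only [InnerProductSpace.toDual_symm_apply] at h1
  rw [h1, hC]
  simp

end IsGaussianWith

end CameronMartinNorm

/-! ### Small balls of the reweighted measure -/

section Reweighted

variable {X : Type*} [NormedAddCommGroup X] {φ : X → ℝ}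

lemma LipschitzOnBounded.continuous (hφ : LipschitzOnBounded φ) : Continuous φ := by
  refine continuous_iff_continuousAt.mpr fun x => ?_
  obtain ⟨K, hK, hlip⟩ := hφ (‖x‖ + 1) (by positivity)
  have hon : LipschitzOnWith K.toNNReal φ (Metric.ball 0 (‖x‖ + 1)) := by
    refine LipschitzOnWith.of_dist_le_mul fun u hu v hv => ?_
    rw [Real.coe_toNNReal _ hK.le, Real.dist_eq, dist_eq_norm]
    exact hlip u v (by simpa using hu) (by simpa using hv)
  exact hon.continuousOn.continuousAt (Metric.isOpen_ball.mem_nhds (by simp))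

lemma LipschitzOnBounded.exists_forall_mem_ball (hφ : LipschitzOnBounded φ) (r : ℝ) :
    ∃ K : ℝ, 0 < K ∧ ∀ z δ, ‖z‖ + δ ≤ r → ∀ x ∈ Metric.ball z δ,
      φ z - K * δ ≤ φ x ∧ φ x ≤ φ z + K * δ := by
  obtain ⟨K, hK, hlip⟩ := hφ (|r| + 1) (by positivity)
  refine ⟨K, hK, fun z δ hzr x hx => ?_⟩
  rw [mem_ball_iff_norm] at hx
  have hr := le_abs_self r
  have h1 := norm_sub_norm_le x z
  have h2 := norm_nonneg (x - z)
  have h3 := abs_le.mp ((hlip x z (by linarith) (by linarith)).trans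
    (mul_le_mul_of_nonneg_left hx.le hK.le))
  constructor <;> linarith [h3.1, h3.2]

variable [MeasurableSpace X]

/-- The unnormalised posterior `exp (-φ) μ`. -/
noncomputable def expWeighted (μ : Measure X) (φ : X → ℝ) : Measure X :=
  μ.withDensity fun u => ENNReal.ofReal (Real.exp (-φ u))

variable [BorelSpace X]

lemma isFiniteMeasure_expWeighted (μ : Measure X) [IsFiniteMeasure μ] {M : ℝ}
    (hM : ∀ u, M ≤ φ u) : IsFiniteMeasure (expWeighted μ φ) := by
  refine isFiniteMeasure_withDensity (ne_top_of_le_ne_top ?_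
    (lintegral_mono fun u => ENNReal.ofReal_le_ofReal (Real.exp_le_exp.mpr (neg_le_neg (hM u)))))
  rw [lintegral_const]
  exact ENNReal.mul_ne_top ENNReal.ofReal_ne_top (measure_ne_top _ _)

lemma expWeighted_le_of_forall_le (μ : Measure X) {A : Set X} (hA : MeasurableSet A) {c : ℝ}
    (hc : ∀ x ∈ A, c ≤ φ x) :
    expWeighted μ φ A ≤ ENNReal.ofReal (Real.exp (-c)) * μ A := by
  rw [expWeighted, withDensity_apply _ hA, ← setLIntegral_const]
  exact setLIntegral_mono' hA fun x hx =>
    ENNReal.ofReal_le_ofReal (Real.exp_le_exp.mpr (neg_le_neg (hc x hx)))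

lemma le_expWeighted_of_forall_le (μ : Measure X) {A : Set X} (hA : MeasurableSet A) {c : ℝ}
    (hc : ∀ x ∈ A, φ x ≤ c) :
    ENNReal.ofReal (Real.exp (-c)) * μ A ≤ expWeighted μ φ A := by
  rw [expWeighted, withDensity_apply _ hA, ← setLIntegral_const]
  exact setLIntegral_mono' hA fun x hx =>
    ENNReal.ofReal_le_ofReal (Real.exp_le_exp.mpr (neg_le_neg (hc x hx)))

variable [InnerProductSpace ℝ X] [CompleteSpace X] [SecondCountableTopology X]

namespace IsGaussianWith

variable {μ : Measure X} {m : X} {C : X →L[ℝ] X}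

lemma expWeighted_ball_le (h : IsGaussianWith μ m C) {z : X} {δ c : ℝ}
    (hc : ∀ x ∈ Metric.ball z δ, c ≤ φ x) (a : X) :
    expWeighted μ φ (Metric.ball z δ) ≤
      ENNReal.ofReal (Real.exp (-c - (⟪a, z - m⟫ - ⟪C a, a⟫ / 2) + δ * ‖a‖)) *
        μ (Metric.ball m δ) := by
  refine (expWeighted_le_of_forall_le μ Metric.isOpen_ball.measurableSet hc).trans ?_
  refine (mul_le_mul_right (h.measure_ball_le_exp_mul_mean z a δ) _).trans ?_
  rw [← mul_assoc, ← ENNReal.ofReal_mul (Real.exp_pos _).le, ← Real.exp_add, ← add_assoc,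
    ← sub_eq_add_neg]

lemma le_expWeighted_ball (h : IsGaussianWith μ m C) {z : X} {δ c J : ℝ}
    (hc : ∀ x ∈ Metric.ball z δ, φ x ≤ c) (hJ : ∀ a, ⟪a, z - m⟫ - ⟪C a, a⟫ / 2 ≤ J) :
    ENNReal.ofReal (Real.exp (-c - J)) * μ (Metric.ball m δ) ≤
      expWeighted μ φ (Metric.ball z δ) := by
  refine le_trans ?_ (le_expWeighted_of_forall_le μ Metric.isOpen_ball.measurableSet hc)
  refine le_trans ?_ (mul_le_mul_right (h.exp_mul_measure_ball_mean_le hJ δ) _)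
  rw [← mul_assoc, ← ENNReal.ofReal_mul (Real.exp_pos _).le, ← Real.exp_add, sub_eq_add_neg]

end IsGaussianWith

end Reweighted

/-! ### Convergence of the centres of maximal balls -/

section Centres

variable {X : Type*} [NormedAddCommGroup X] [InnerProductSpace ℝ X] [CompleteSpace X]
  [SecondCountableTopology X] [MeasurableSpace X] [BorelSpace X]
  {φ : X → ℝ} {μ : Measure X} {m : X} {C : X →L[ℝ] X}

namespace IsGaussianWith

lemma mul_measure_ball_le_iff (h : IsGaussianWith μ m C) {δ s t : ℝ} (hδ : 0 < δ) :
    ENNReal.ofReal (Real.exp s) * μ (Metric.ball m δ) ≤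
      ENNReal.ofReal (Real.exp t) * μ (Metric.ball m δ) ↔ s ≤ t := by
  have := h.isGaussian
  rw [ENNReal.mul_le_mul_iff_left (h.measure_ball_mean_pos hδ).ne' (measure_ne_top _ _),
    ENNReal.ofReal_le_ofReal_iff (Real.exp_pos _).le, Real.exp_le_exp]

/-- Centres of maximal balls of radius at most `1` nearly satisfy the bound that characterises a ball
of the Cameron–Martin space: their balls are at least as likely as those around the mean. -/
lemma exists_forall_le_of_isMaximalBallCentre (h : IsGaussianWith μ m C)
    (hφ : LipschitzOnBounded φ) {M : ℝ} (hM : ∀ u, M ≤ φ u) :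
    ∃ K : ℝ, 0 < K ∧ ∀ z δ, 0 < δ → δ ≤ 1 → IsMaximalBallCentre (expWeighted μ φ) δ z →
      ∀ a, ⟪a, z - m⟫ - ⟪C a, a⟫ / 2 ≤ K + δ * ‖a‖ := by
  obtain ⟨K, hK, hlip⟩ := hφ.exists_forall_mem_ball (‖m‖ + 1)
  refine ⟨φ m - M + K, by linarith [hM m], fun z δ hδ hδ1 hz a => ?_⟩
  have h1 := h.le_expWeighted_ball (z := m) (δ := δ) (J := 0)
    (fun x hx => (hlip m δ (by linarith) x hx).2)
    (fun a => by
      have := h.inner_map_self_nonneg a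
      rw [sub_self, inner_zero_right]
      linarith)
  have h2 := (h1.trans (hz m)).trans (h.expWeighted_ball_le (fun x _ => hM x) a)
  rw [h.mul_measure_ball_le_iff hδ] at h2
  nlinarith

/-- A sequence satisfying the approximate Cameron–Martin bound is bounded, so it has a weakly
convergent subsequence. Testing the bound with large multiples of the difference to the weak limit,
along which the covariance form tends to zero, shows that the convergence is strong. -/
lemma exists_subseq_tendsto (h : IsGaussianWith μ m C) {K : ℝ} {w : ℕ → X} {δ : ℕ → ℝ}
    (hδ1 : ∀ n, δ n ≤ 1) (hδ : Tendsto δ atTop (𝓝 0))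
    (hw : ∀ n a, ⟪a, w n⟫ - ⟪C a, a⟫ / 2 ≤ K + δ n * ‖a‖) :
    ∃ (k : ℕ → ℕ) (b : X), StrictMono k ∧ Tendsto (fun n => w (k n)) atTop (𝓝 b) ∧
      ∀ a, ⟪a, b⟫ - ⟪C a, a⟫ / 2 ≤ K := by
  have hbound : ∀ n, ‖w n‖ ≤ K + 1 + ‖C‖ / 2 := by
    intro n
    rcases eq_or_ne (w n) 0 with h0 | h0
    · have h1 := hw n 0
      have h2 : (0 : ℝ) ≤ K := by simpa using h1
      rw [h0, norm_zero]; positivity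
    · set e := ‖w n‖⁻¹ • w n with he
      have hpos : 0 < ‖w n‖ := norm_pos_iff.mpr h0
      have hen : ‖e‖ = 1 := by
        rw [he, norm_smul, norm_inv, norm_norm, inv_mul_cancel₀ hpos.ne']
      have h1 := hw n e
      have h2 : ⟪e, w n⟫ = ‖w n‖ := by
        rw [he, real_inner_smul_left, real_inner_self_eq_norm_sq, sq, inv_mul_cancel_left₀ hpos.ne']
      have h3 : ⟪C e, e⟫ ≤ ‖C‖ := by
        refine (real_inner_le_norm _ _).trans ?_
        have := C.le_opNorm e
        rw [hen] at this ⊢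
        linarith
      rw [h2, hen] at h1
      linarith [hδ1 n]
  obtain ⟨b, k, hk, hb⟩ := exists_subseq_weakTendsto hbound
  have hδk : Tendsto (fun n => δ (k n)) atTop (𝓝 0) := hδ.comp hk.tendsto_atTop
  have hbK : ∀ a, ⟪a, b⟫ - ⟪C a, a⟫ / 2 ≤ K := by
    intro a
    have h1 : Tendsto (fun n => K + δ (k n) * ‖a‖) atTop (𝓝 (K + 0 * ‖a‖)) :=
      (hδk.mul_const _).const_add _
    rw [zero_mul, add_zero] at h1
    exact le_of_tendsto_of_tendsto' ((hb a).sub_const _) h1 fun n => hw (k n) a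
  have hK0 : 0 ≤ K := by simpa using hbK 0
  refine ⟨k, b, hk, ?_, hbK⟩
  set d : ℕ → X := fun n => w (k n) - b with hd
  have hdweak : WeakTendsto d 0 := by
    intro a
    simpa [hd, inner_sub_right] using (hb a).sub_const ⟪a, b⟫
  have hdbound : ∀ n, ‖d n‖ ≤ K + 1 + ‖C‖ / 2 + ‖b‖ := fun n =>
    (norm_sub_le _ _).trans (add_le_add_left (hbound (k n)) _)
  have hq := h.map_sub_mean.tendsto_inner_map_self_of_weakTendsto_zero hdbound hdweak
  have hineq : ∀ s : ℝ, 0 < s → ∀ n,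
      ‖d n‖ ^ 2 ≤ s * ⟪C (d n), d n⟫ / 2 + K / s + |δ (k n)| * (K + 1 + ‖C‖ / 2 + ‖b‖)
        - ⟪b, d n⟫ := by
    intro s hs n
    have h1 := hw (k n) (s • d n)
    have h2 : w (k n) = d n + b := (sub_add_cancel _ _).symm
    rw [map_smul, real_inner_smul_left, real_inner_smul_left, real_inner_smul_right, norm_smul,
      Real.norm_of_nonneg hs.le, h2, inner_add_right, real_inner_self_eq_norm_sq,
      real_inner_comm] at h1
    have h3 : δ (k n) * ‖d n‖ ≤ |δ (k n)| * (K + 1 + ‖C‖ / 2 + ‖b‖) :=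
      mul_le_mul (le_abs_self _) (hdbound n) (norm_nonneg _) (abs_nonneg _)
    have h4 : s * (K / s) = K := by field_simp
    refine le_of_mul_le_mul_left ?_ hs
    nlinarith
  have hsq : Tendsto (fun n => ‖d n‖ ^ 2) atTop (𝓝 0) := by
    refine tendsto_order.mpr ⟨fun c hc => Eventually.of_forall fun n => hc.trans_le (sq_nonneg _),
      fun c hc => ?_⟩
    set s := (K + 1) / c with hs
    have hspos : 0 < s := by positivity
    have hlim : Tendsto (fun n => s * ⟪C (d n), d n⟫ / 2 + K / s +
        |δ (k n)| * (K + 1 + ‖C‖ / 2 + ‖b‖) - ⟪b, d n⟫) atTop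
        (𝓝 (s * 0 / 2 + K / s + |0| * (K + 1 + ‖C‖ / 2 + ‖b‖) - ⟪b, (0 : X)⟫)) :=
      (((((hq.const_mul s).div_const 2).add_const _)).add (hδk.abs.mul_const _)).sub (hdweak b)
    have hlt : s * 0 / 2 + K / s + |0| * (K + 1 + ‖C‖ / 2 + ‖b‖) - ⟪b, (0 : X)⟫ < c := by
      rw [abs_zero, inner_zero_right, mul_zero, zero_div, zero_mul, zero_add, add_zero, sub_zero,
        hs, div_div_eq_mul_div, div_lt_iff₀ (by linarith)]
      nlinarith
    filter_upwards [hlim.eventually_lt_const hlt] with n hn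
    exact (hineq s hspos n).trans_lt hn
  have hnorm : Tendsto (fun n => ‖d n‖) atTop (𝓝 0) := by
    have h1 := hsq.sqrt
    simpa [Real.sqrt_sq (norm_nonneg _)] using h1
  exact tendsto_iff_norm_sub_tendsto_zero.mpr hnorm

/-- The comparison of the balls around a point `u` and around a nearby centre, in the limit of small
radii. -/
lemma le_of_tendsto_of_mul_measure_ball_le (h : IsGaussianWith μ m C) (hφ : LipschitzOnBounded φ)
    {z : ℕ → X} {b : X} {δ : ℕ → ℝ} (hδpos : ∀ n, 0 < δ n) (hδ : Tendsto δ atTop (𝓝 0))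
    (hz : Tendsto z atTop (𝓝 b)) {u : X} {J s : ℝ}
    (hle : ∀ n, expWeighted μ φ (Metric.ball u (δ n)) ≤
      ENNReal.ofReal (Real.exp s) * expWeighted μ φ (Metric.ball (z n) (δ n)))
    (hJ : ∀ a, ⟪a, u - m⟫ - ⟪C a, a⟫ / 2 ≤ J) (a : X) :
    φ b + (⟪a, b - m⟫ - ⟪C a, a⟫ / 2) ≤ φ u + J + s := by
  obtain ⟨K, hK, hlip⟩ := hφ.exists_forall_mem_ball (‖b‖ + ‖u‖ + 2)
  have hev : ∀ᶠ n in atTop, φ (z n) + (⟪a, z n - m⟫ - ⟪C a, a⟫ / 2) ≤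
      φ u + J + s + (2 * K + ‖a‖) * δ n := by
    filter_upwards [hδ.eventually_lt_const one_pos,
      hz.norm.eventually_lt_const (lt_add_one ‖b‖)] with n hn1 hn2
    have h1 := h.le_expWeighted_ball (z := u) (δ := δ n)
      (fun x hx => (hlip u (δ n) (by linarith [norm_nonneg b]) x hx).2) hJ
    have h2 := h.expWeighted_ball_le (z := z n) (δ := δ n)
      (fun x hx => (hlip (z n) (δ n) (by linarith [norm_nonneg u]) x hx).1) a
    have h3 := (h1.trans (hle n)).trans (mul_le_mul_right h2 _)
    rw [← mul_assoc, ← ENNReal.ofReal_mul (Real.exp_pos _).le, ← Real.exp_add,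
      h.mul_measure_ball_le_iff (hδpos n)] at h3
    linarith
  have hl : Tendsto (fun n => φ (z n) + (⟪a, z n - m⟫ - ⟪C a, a⟫ / 2)) atTop
      (𝓝 (φ b + (⟪a, b - m⟫ - ⟪C a, a⟫ / 2))) := by
    have hc : Continuous fun x => φ x + (⟪a, x - m⟫ - ⟪C a, a⟫ / 2) := by
      have := hφ.continuous
      fun_prop
    exact (hc.tendsto b).comp hz
  have hr : Tendsto (fun n => φ u + J + s + (2 * K + ‖a‖) * δ n) atTop
      (𝓝 (φ u + J + s + (2 * K + ‖a‖) * 0)) := (hδ.const_mul _).const_add _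
  rw [mul_zero, add_zero] at hr
  exact le_of_tendsto_of_tendsto hl hr hev

/-- Maximal balls exist by weak upper semicontinuity, which holds for closed balls; open balls have the
same measure because spheres are null sets, except for a Dirac measure. -/
lemma exists_isMaximalBallCentre (h : IsGaussianWith μ m C) (hφ : LipschitzOnBounded φ) {M : ℝ}
    (hM : ∀ u, M ≤ φ u) {δ : ℝ} (hδ : 0 < δ) :
    ∃ z, IsMaximalBallCentre (expWeighted μ φ) δ z := by
  have := h.isGaussian
  have hfin := isFiniteMeasure_expWeighted μ hM
  have hac : expWeighted μ φ ≪ μ := withDensity_absolutelyContinuous _ _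
  by_cases hC : C = 0
  -- the Dirac measure, for which spheres need not be null
  · refine ⟨m, fun w => ?_⟩
    have h0 : expWeighted μ φ (Metric.ball m δ)ᶜ = 0 := by
      refine hac ?_
      rw [h.eq_dirac_of_eq_zero hC, Measure.dirac_apply' _ Metric.isOpen_ball.measurableSet.compl]
      simp [hδ]
    refine measure_mono_ae ?_
    filter_upwards [measure_eq_zero_iff_ae_notMem.mp h0] with x hx _
    exact not_not.mp hx
  have hball : ∀ w, expWeighted μ φ (Metric.ball w δ) = expWeighted μ φ (Metric.closedBall w δ) := by
    intro w
    refine le_antisymm (measure_mono Metric.ball_subset_closedBall) ?_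
    rw [← Metric.ball_union_sphere]
    refine (measure_union_le _ _).trans ?_
    rw [hac (h.measure_sphere_eq_zero_of_ne hC w δ), add_zero]
  have hpos : 0 < expWeighted μ φ (Metric.ball m δ) := by
    obtain ⟨K, hK, hlip⟩ := hφ.exists_forall_mem_ball (‖m‖ + δ)
    refine lt_of_lt_of_le ?_ (le_expWeighted_of_forall_le μ Metric.isOpen_ball.measurableSet
      fun x hx => (hlip m δ le_rfl x hx).2)
    exact ENNReal.mul_pos (by simpa using Real.exp_pos _) (h.measure_ball_mean_pos hδ).ne'
  obtain ⟨R, hR⟩ := exists_forall_measure_ball_le (expWeighted μ φ) hpos δ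
  obtain ⟨z, hz⟩ := exists_forall_le_of_weak_usc (R := R) (u := m)
    (F := fun w => expWeighted μ φ (Metric.ball w δ))
    (fun w z hwz => by
      simp only [hball]
      exact hwz.limsup_measure_closedBall_le _ δ) hR
  exact ⟨z, hz⟩

lemma exists_subseq_tendsto_of_isMaximalBallCentre (h : IsGaussianWith μ m C)
    (hφ : LipschitzOnBounded φ) {M : ℝ} (hM : ∀ u, M ≤ φ u) {z : ℕ → X} {δ : ℕ → ℝ}
    (hδpos : ∀ n, 0 < δ n) (hδ : Tendsto δ atTop (𝓝 0))
    (hz : ∀ n, IsMaximalBallCentre (expWeighted μ φ) (δ n) (z n)) :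
    ∃ (k : ℕ → ℕ) (b : X), StrictMono k ∧ b - m ∈ cameronMartinSpace μ ∧
      Tendsto (fun n => z (k n)) atTop (𝓝 b) ∧
      ∀ u, u - m ∈ cameronMartinSpace μ →
        φ b + 1 / 2 * (cameronMartinNorm μ (b - m)).toReal ^ 2 ≤
          φ u + 1 / 2 * (cameronMartinNorm μ (u - m)).toReal ^ 2 := by
  obtain ⟨K, hK, hbd⟩ := h.exists_forall_le_of_isMaximalBallCentre hφ hM
  -- radii larger than `1`, for which the bound is not available, are skipped
  obtain ⟨N, hN⟩ := eventually_atTop.mp (hδ.eventually_le_const one_pos)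
  obtain ⟨k, b, hk, hb, hbK⟩ := h.exists_subseq_tendsto (K := K) (w := fun n => z (n + N) - m)
    (δ := fun n => δ (n + N)) (fun n => hN _ (Nat.le_add_left _ _))
    (hδ.comp (tendsto_add_atTop_nat N))
    (fun n => hbd _ _ (hδpos _) (hN _ (Nat.le_add_left _ _)) (hz _))
  have hk' : StrictMono fun n => k n + N := hk.add_const N
  have hlim : Tendsto (fun n => z (k n + N)) atTop (𝓝 (b + m)) := by
    simpa using hb.add_const m
  have hE : b + m - m ∈ cameronMartinSpace μ := by
    rw [add_sub_cancel_right]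
    exact h.mem_cameronMartinSpace hbK
  refine ⟨fun n => k n + N, b + m, hk', hE, hlim, fun u hu => ?_⟩
  have hup := (h.isLUB_cameronMartinNorm hE).2
  rw [← le_sub_iff_add_le']
  refine hup ?_
  rintro _ ⟨a, rfl⟩
  have h1 := h.le_of_tendsto_of_mul_measure_ball_le hφ (fun n => hδpos (k n + N))
    (hδ.comp hk'.tendsto_atTop) hlim (u := u) (s := 0)
    (fun n => by simpa using hz (k n + N) u)
    (fun a => (h.isLUB_cameronMartinNorm hu).1 ⟨a, rfl⟩) a
  dsimp only
  linarith

/-- A minimiser of the Onsager–Machlup functional over the Cameron–Martin space is a MAP estimate, if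
maximal balls exist: otherwise the balls around the minimiser would be smaller by a fixed factor than
maximal balls of certain radii tending to zero, whose centres converge along a subsequence to a point
at which the functional would be strictly smaller. -/
lemma isMAPEstimate_of_forall_le (h : IsGaussianWith μ m C) (hφ : LipschitzOnBounded φ) {M : ℝ}
    (hM : ∀ u, M ≤ φ u) {b : X} (hE : b - m ∈ cameronMartinSpace μ)
    (hmin : ∀ u, u - m ∈ cameronMartinSpace μ →
        φ b + 1 / 2 * (cameronMartinNorm μ (b - m)).toReal ^ 2 ≤
          φ u + 1 / 2 * (cameronMartinNorm μ (u - m)).toReal ^ 2) :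
    IsMAPEstimate (expWeighted μ φ) b := by
  have := h.isGaussian
  have hfin := isFiniteMeasure_expWeighted μ hM
  have hone : ∀ δ : ℝ, expWeighted μ φ (Metric.ball b δ) /
      ⨆ w, expWeighted μ φ (Metric.ball w δ) ≤ 1 := fun δ =>
    ENNReal.div_le_of_le_mul (by
      rw [one_mul]; exact le_iSup (fun w => expWeighted μ φ (Metric.ball w δ)) b)
  refine tendsto_order.mpr ⟨fun c hc => ?_, fun c hc =>
    Eventually.of_forall fun δ => (hone δ).trans_lt hc⟩
  by_contra hnot
  rw [not_eventually] at hnot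
  obtain ⟨δ, hδlim, hδ⟩ := exists_seq_forall_of_frequently
    (hnot.and_eventually self_mem_nhdsWithin)
  have hδpos : ∀ n, 0 < δ n := fun n => (hδ n).2
  have hδ0 : Tendsto δ atTop (𝓝 0) := hδlim.mono_right nhdsWithin_le_nhds
  choose z hz using fun n => h.exists_isMaximalBallCentre hφ hM (hδpos n)
  obtain ⟨k, b', hk, hE', hlim, -⟩ :=
    h.exists_subseq_tendsto_of_isMaximalBallCentre hφ hM hδpos hδ0 hz
  have hsup : ∀ n, ⨆ w, expWeighted μ φ (Metric.ball w (δ n)) =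
      expWeighted μ φ (Metric.ball (z n) (δ n)) := fun n =>
    le_antisymm (iSup_le (hz n)) (le_iSup (fun w => expWeighted μ φ (Metric.ball w (δ n))) (z n))
  -- a real number `exp s` strictly between `c` and `1`
  obtain ⟨c', hcc', hc'1⟩ := exists_between hc
  have hc'top : c' ≠ ∞ := (hc'1.trans ENNReal.one_lt_top).ne
  have hc'pos : 0 < c'.toReal := ENNReal.toReal_pos (zero_le.trans_lt hcc').ne' hc'top
  set s := Real.log c'.toReal with hs
  have hexp : ENNReal.ofReal (Real.exp s) = c' := by
    rw [hs, Real.exp_log hc'pos, ENNReal.ofReal_toReal hc'top]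
  have hs0 : s < 0 := by
    refine Real.log_neg hc'pos ?_
    have := (ENNReal.toReal_lt_toReal hc'top ENNReal.one_ne_top).mpr hc'1
    simpa using this
  have hle : ∀ n, expWeighted μ φ (Metric.ball b (δ n)) ≤
      ENNReal.ofReal (Real.exp s) * expWeighted μ φ (Metric.ball (z n) (δ n)) := by
    intro n
    have h1 := (not_lt.mp (hδ n).1).trans hcc'.le
    rw [hsup] at h1
    rw [hexp]
    rcases eq_or_ne (expWeighted μ φ (Metric.ball (z n) (δ n))) 0 with h0 | h0
    · exact (hz n b).trans (by rw [h0]; exact zero_le)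
    · exact (ENNReal.div_le_iff h0 (measure_ne_top _ _)).mp h1
  have hfinal : 1 / 2 * (cameronMartinNorm μ (b' - m)).toReal ^ 2 ≤
      φ b + 1 / 2 * (cameronMartinNorm μ (b - m)).toReal ^ 2 + s - φ b' := by
    refine (h.isLUB_cameronMartinNorm hE').2 ?_
    rintro _ ⟨a, rfl⟩
    have h1 := h.le_of_tendsto_of_mul_measure_ball_le hφ (fun n => hδpos (k n))
      (hδ0.comp hk.tendsto_atTop) hlim (fun n => hle (k n))
      (fun a => (h.isLUB_cameronMartinNorm hE).1 ⟨a, rfl⟩) a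
    dsimp only
    linarith
  linarith [hmin b' hE']

lemma maximalBallCentresConverge_bayesPosterior (h : IsGaussianWith μ m C)
    (hφ : LipschitzOnBounded φ) {M : ℝ} (hM : ∀ u, M ≤ φ u) :
    MaximalBallCentresConverge μ m φ (bayesPosterior μ φ) := by
  have := h.isGaussian
  have hfin := isFiniteMeasure_expWeighted μ hM
  have hφm := hφ.continuous.measurable
  set Z := ∫⁻ v, ENNReal.ofReal (Real.exp (-φ v)) ∂μ with hZ
  have hZu : Z = expWeighted μ φ Set.univ := by
    rw [expWeighted, withDensity_apply _ .univ, Measure.restrict_univ]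
  have hZtop : Z⁻¹ ≠ 0 := by
    rw [Ne, ENNReal.inv_eq_zero, hZu]
    exact measure_ne_top _ _
  have hZ0 : Z⁻¹ ≠ ∞ := by
    rw [Ne, ENNReal.inv_eq_top, hZ, lintegral_eq_zero_iff (by fun_prop)]
    intro h0
    obtain ⟨u, hu⟩ := h0.exists
    simp only [Pi.zero_apply, ENNReal.ofReal_eq_zero] at hu
    exact absurd hu (not_le.mpr (Real.exp_pos _))
  have hpost : bayesPosterior μ φ = Z⁻¹ • expWeighted μ φ := by
    rw [bayesPosterior, expWeighted, ← withDensity_smul _ (by fun_prop)]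
    congr 1
    funext u
    rw [Pi.smul_apply, smul_eq_mul, ENNReal.div_eq_inv_mul]
  have hmax : ∀ δ z, IsMaximalBallCentre (bayesPosterior μ φ) δ z ↔
      IsMaximalBallCentre (expWeighted μ φ) δ z := by
    intro δ z
    simp only [IsMaximalBallCentre, hpost, Measure.smul_apply, smul_eq_mul,
      ENNReal.mul_le_mul_iff_right hZtop hZ0]
  have hMAP : ∀ z, IsMAPEstimate (expWeighted μ φ) z → IsMAPEstimate (bayesPosterior μ φ) z := by
    intro z hz
    simpa only [IsMAPEstimate, hpost, Measure.smul_apply, smul_eq_mul, ← ENNReal.mul_iSup,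
      ENNReal.mul_div_mul_left _ _ hZtop hZ0] using hz
  refine ⟨fun δ hδ => ?_, fun z hz δ hδpos hδ => ?_⟩
  · obtain ⟨z, hz⟩ := h.exists_isMaximalBallCentre hφ hM hδ
    exact ⟨z, (hmax δ z).mpr hz⟩
  · obtain ⟨k, b, hk, hE, hlim, hmin⟩ := h.exists_subseq_tendsto_of_isMaximalBallCentre hφ hM hδpos
      hδ (z := fun n => z (δ n)) fun n => (hmax _ _).mp (hz _ (hδpos n))
    refine ⟨k, b, hk, hE, hlim, hMAP b (h.isMAPEstimate_of_forall_le hφ hM hE hmin), fun u => ?_⟩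
    by_cases hu : u - m ∈ cameronMartinSpace μ
    · simp only [onsagerMachlup, if_pos hE, if_pos hu]
      exact EReal.coe_le_coe_iff.mpr (hmin u hu)
    · simp only [onsagerMachlup, if_neg hu]
      exact le_top

end IsGaussianWith

end Centres

/-! ### Bayes' formula for the conditional law -/

section Bayes

variable {Ω X Y : Type*} [MeasurableSpace Ω]
  [NormedAddCommGroup X] [InnerProductSpace ℝ X] [CompleteSpace X] [SecondCountableTopology X]
  [MeasurableSpace X] [BorelSpace X]
  [NormedAddCommGroup Y] [InnerProductSpace ℝ Y] [CompleteSpace Y] [SecondCountableTopology Y]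
  [MeasurableSpace Y] [BorelSpace Y]

/-- The posterior of a jointly measurable potential, as a kernel in the datum. Where the normalising
constant is infinite the density, and hence the measure, is zero. -/
noncomputable def posteriorKernel (μ : Measure X) [IsProbabilityMeasure μ] (Φ : X × Y → ℝ) :
    Kernel Y X :=
  Kernel.withDensity (Kernel.const Y μ) fun v u =>
    ENNReal.ofReal (Real.exp (-Φ (u, v))) / ∫⁻ u', ENNReal.ofReal (Real.exp (-Φ (u', v))) ∂μ

variable {μ : Measure X} [IsProbabilityMeasure μ] {Φ : X × Y → ℝ}

lemma measurable_lintegral_exp_neg (hΦ : Measurable Φ) :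
    Measurable fun v => ∫⁻ u', ENNReal.ofReal (Real.exp (-Φ (u', v))) ∂μ :=
  Measurable.lintegral_prod_left' (f := fun p : X × Y => ENNReal.ofReal (Real.exp (-Φ p)))
    (by fun_prop)

lemma measurable_posteriorDensity (hΦ : Measurable Φ) :
    Measurable (Function.uncurry fun (v : Y) (u : X) => ENNReal.ofReal (Real.exp (-Φ (u, v))) /
      ∫⁻ u', ENNReal.ofReal (Real.exp (-Φ (u', v))) ∂μ) := by
  have h1 := (measurable_lintegral_exp_neg (μ := μ) hΦ).comp 
    (measurable_fst : Measurable (Prod.fst : Y × X → Y))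
  have h2 : Measurable fun p : Y × X => ENNReal.ofReal (Real.exp (-Φ (p.2, p.1))) := by fun_prop
  exact h2.div h1

lemma posteriorKernel_apply (hΦ : Measurable Φ) (v : Y) :
    posteriorKernel μ Φ v = bayesPosterior μ fun u => Φ (u, v) := by
  rw [posteriorKernel, Kernel.withDensity_apply _ (measurable_posteriorDensity hΦ),
    Kernel.const_apply, bayesPosterior]

lemma isFiniteKernel_posteriorKernel (hΦ : Measurable Φ) : IsFiniteKernel (posteriorKernel μ Φ) := by
  refine ⟨1, ENNReal.one_lt_top, fun v => ?_⟩
  rw [posteriorKernel_apply hΦ, bayesPosterior, withDensity_apply _ .univ, Measure.restrict_univ]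
  simp only [div_eq_mul_inv]
  rw [lintegral_mul_const _ (by fun_prop), ← div_eq_mul_inv]
  exact ENNReal.div_self_le_one

lemma bayesPosterior_congr {φ ψ : X → ℝ} (h : φ =ᵐ[μ] ψ) :
    bayesPosterior μ φ = bayesPosterior μ ψ := by
  have h1 : (fun u => ENNReal.ofReal (Real.exp (-φ u))) =ᵐ[μ]
      fun u => ENNReal.ofReal (Real.exp (-ψ u)) := by
    filter_upwards [h] with u hu
    rw [hu]
  rw [bayesPosterior, bayesPosterior, lintegral_congr_ae h1]
  refine withDensity_congr_ae ?_
  filter_upwards [h1] with u hu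
  rw [hu]

/-- Bayes' formula: for a potential of the observation model, the conditional law of the unknown
given the datum is the posterior. The factor `c` of the observation density cancels, and the
normalising constant is finite for almost every datum because the law of the datum is finite. -/
lemma IsPotential.condDistrib_ae_eq_bayesPosterior {P : Measure Ω} [IsProbabilityMeasure P]
    {x : Ω → X} {y : Ω → Y} {Q : Measure Y} [IsProbabilityMeasure Q] {Φ : X → Y → ℝ}
    (hx : Measurable x) (hy : Measurable y) (hΦ : IsPotential P x y Q Φ) :
    ∀ᵐ v ∂(P.map y), condDistrib x y P v = bayesPosterior (P.map x) fun u => Φ u v := by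
  have hμ : IsProbabilityMeasure (P.map x) := Measure.isProbabilityMeasure_map hx.aemeasurable
  set μ := P.map x with hμdef
  obtain ⟨c, hc, hcpos, hdens⟩ := hΦ.density
  -- a jointly measurable version of the potential
  set Ψ : X × Y → ℝ := hΦ.aemeasurable.mk (Function.uncurry Φ) with hΨ
  have hΨm : Measurable Ψ := hΦ.aemeasurable.measurable_mk
  have hΨae : Function.uncurry Φ =ᵐ[μ.prod Q] Ψ := hΦ.aemeasurable.ae_eq_mk
  set f : X × Y → ℝ≥0∞ := fun p => ENNReal.ofReal (Real.exp (-Ψ p)) with hf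
  have hfm : Measurable f := by fun_prop
  set g : Y → ℝ≥0∞ := fun v => ∫⁻ u, f (u, v) ∂μ with hg
  have hgm : Measurable g := measurable_lintegral_exp_neg hΨm
  set d : Y → ℝ≥0∞ := fun v => (ENNReal.ofReal (c v))⁻¹ with hd
  have hdm : Measurable d := by fun_prop
  have hd0 : ∀ v, d v ≠ 0 := fun v => ENNReal.inv_ne_zero.mpr ENNReal.ofReal_ne_top
  have hcond : ∀ᵐ u ∂μ, condDistrib y x P u = Q.withDensity fun v => f (u, v) * d v := by
    filter_upwards [hdens, Measure.ae_ae_of_ae_prod hΨae] with u hu1 hu2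
    rw [← Measure.withDensity_rnDeriv_eq _ _ hu1.1]
    refine withDensity_congr_ae ?_
    filter_upwards [hu1.2, hu2] with v hv1 hv2
    rw [hv1, ENNReal.ofReal_div_of_pos (hcpos v), div_eq_mul_inv, hf, hd]
    simp only [← hv2, Function.uncurry_apply_pair]
  have hjoint : ∀ k : Y × X → ℝ≥0∞, Measurable k →
      ∫⁻ p, k p ∂(P.map fun ω => (y ω, x ω)) = ∫⁻ v, ∫⁻ u, f (u, v) * d v * k (v, u) ∂μ ∂Q := by
    intro k hk
    have h1 : ∫⁻ p, k p ∂(P.map fun ω => (y ω, x ω)) =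
        ∫⁻ p, k p.swap ∂(P.map fun ω => (x ω, y ω)) := by
      rw [lintegral_map hk (by fun_prop), lintegral_map (by fun_prop) (by fun_prop)]
      rfl
    rw [h1, ← compProd_map_condDistrib hy.aemeasurable, Measure.lintegral_compProd (by fun_prop),
      lintegral_lintegral_swap (by fun_prop)]
    refine lintegral_congr_ae ?_
    filter_upwards [hcond] with u hu
    rw [hu, lintegral_withDensity_eq_lintegral_mul _ (by fun_prop) (by fun_prop)]
    rfl
  have hlaw : P.map y = Q.withDensity fun v => g v * d v := by
    ext s hs
    have hsm : Measurable fun p : Y × X => s.indicator (1 : Y → ℝ≥0∞) p.1 :=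
      (measurable_one.indicator hs).comp measurable_fst
    have h1 := hjoint _ hsm
    rw [lintegral_map hsm (by fun_prop)] at h1
    rw [withDensity_apply _ hs, Measure.map_apply hy hs, ← lintegral_indicator hs,
      ← lintegral_indicator_one (hy hs)]
    refine Eq.trans ?_ (h1.trans ?_)
    · rfl
    · refine lintegral_congr fun v => ?_
      dsimp only
      rw [lintegral_mul_const _ (by fun_prop), lintegral_mul_const _ (by fun_prop)]
      by_cases hv : v ∈ s <;> simp [hv, hg]
  have hgtop : ∀ᵐ v ∂Q, g v ≠ ∞ := by
    have h1 : ∫⁻ v, g v * d v ∂Q ≠ ∞ := by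
      have h2 : ∫⁻ v, g v * d v ∂Q = P.map y Set.univ := by
        rw [hlaw, withDensity_apply _ .univ, Measure.restrict_univ]
      rw [h2]
      have := Measure.isProbabilityMeasure_map (μ := P) hy.aemeasurable
      exact measure_ne_top _ _
    filter_upwards [ae_lt_top (by fun_prop) h1] with v hv htop
    rw [htop, ENNReal.top_mul (hd0 v)] at hv
    exact lt_irrefl _ hv
  have hg0 : ∀ v, g v ≠ 0 := by
    intro v h0
    rw [hg] at h0
    simp only at h0
    rw [lintegral_eq_zero_iff (by fun_prop)] at h0
    obtain ⟨u, hu⟩ := h0.exists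
    simp only [hf, Pi.zero_apply, ENNReal.ofReal_eq_zero] at hu
    exact absurd hu (not_le.mpr (Real.exp_pos _))
  have hfin : IsFiniteKernel (posteriorKernel μ Ψ) := isFiniteKernel_posteriorKernel hΨm
  have hkernel : condDistrib x y P =ᵐ[P.map y] posteriorKernel μ Ψ := by
    refine condDistrib_ae_eq_of_measure_eq_compProd y hx.aemeasurable ?_
    refine Measure.ext_of_lintegral _ fun k hk => ?_
    have hkm : Measurable fun v => ∫⁻ u, k (v, u) ∂(posteriorKernel μ Ψ v) :=
      Measurable.lintegral_kernel_prod_right' hk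
    rw [hjoint k hk, Measure.lintegral_compProd hk, hlaw,
      lintegral_withDensity_eq_lintegral_mul _ (by fun_prop) hkm]
    refine lintegral_congr_ae ?_
    filter_upwards [hgtop] with v hv
    rw [Pi.mul_apply, posteriorKernel_apply hΨm, bayesPosterior,
      lintegral_withDensity_eq_lintegral_mul _ (by fun_prop) (by fun_prop),
      ← lintegral_const_mul _ (by fun_prop)]
    refine lintegral_congr fun u => ?_
    change f (u, v) * d v * k (v, u) = g v * d v * (f (u, v) / g v * k (v, u))
    calc f (u, v) * d v * k (v, u) = g v * (g v)⁻¹ * (f (u, v) * d v * k (v, u)) := by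
          rw [ENNReal.mul_inv_cancel (hg0 v) hv, one_mul]
      _ = _ := by rw [div_eq_mul_inv]; ring
  have hac : P.map y ≪ Q := by
    rw [hlaw]
    exact withDensity_absolutelyContinuous _ _
  have hswap : ∀ᵐ v ∂Q, (fun u => Φ u v) =ᵐ[μ] fun u => Ψ (u, v) :=
    Measure.ae_ae_of_ae_prod
      ((Measure.measurePreserving_swap (μ := Q) (ν := μ)).quasiMeasurePreserving.ae hΨae)
  filter_upwards [hkernel, hac.ae_le hswap] with v hv1 hv2
  rw [hv1, posteriorKernel_apply hΨm, bayesPosterior_congr hv2]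

end Bayes

theorem mainTheorem9 {Ω X Y : Type*} [MeasurableSpace Ω]
    [NormedAddCommGroup X] [InnerProductSpace ℝ X] [CompleteSpace X] [SecondCountableTopology X]
    [MeasurableSpace X] [BorelSpace X]
    [NormedAddCommGroup Y] [InnerProductSpace ℝ Y] [CompleteSpace Y] [SecondCountableTopology Y]
    [MeasurableSpace Y] [BorelSpace Y]
    (P : Measure Ω) [IsProbabilityMeasure P]
    (x : Ω → X) (ε η : Ω → Y) (xbar : X) (εbar : Y)
    (Cx : X →L[ℝ] X) (Cε Cη : Y →L[ℝ] Y)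
    (hmodel : GaussianModel P x ε η xbar εbar Cx Cε Cη)
    (Ga : X → Y) (hGa : Measurable Ga)
    (Φ : X → Y → ℝ) :
    -- every datum `v`, with the posterior given by Bayes' formula
    (∀ v : Y, LipschitzOnBounded (fun u => Φ u v) → (∃ M : ℝ, ∀ u : X, M ≤ Φ u v) →
      MaximalBallCentresConverge (P.map x) xbar (fun u => Φ u v)
        (bayesPosterior (P.map x) (fun u => Φ u v))) ∧
    -- almost every datum `v`, with the posterior as the conditional law of `x` given `y = v`
    (IsPotential P x (fun ω => Ga (x ω) + ε ω + η ω) (P.map η) Φ →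
      ∀ᵐ v ∂(P.map (fun ω => Ga (x ω) + ε ω + η ω)),
        LipschitzOnBounded (fun u => Φ u v) → (∃ M : ℝ, ∀ u : X, M ≤ Φ u v) →
          MaximalBallCentresConverge (P.map x) xbar (fun u => Φ u v)
            (condDistrib x (fun ω => Ga (x ω) + ε ω + η ω) P v)) := by
  have hprior := hmodel.prior
  have hnoise := hmodel.noise.isGaussian
  refine ⟨fun v hφ ⟨M, hM⟩ => hprior.maximalBallCentresConverge_bayesPosterior hφ hM, fun hΦ => ?_⟩
  have hx := hmodel.measurable_x
  have hy : Measurable fun ω => Ga (x ω) + ε ω + η ω :=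
    ((hGa.comp hx).add hmodel.measurable_ε).add hmodel.measurable_η
  filter_upwards [hΦ.condDistrib_ae_eq_bayesPosterior hx hy] with v hv hφ ⟨M, hM⟩
  rw [hv]
  exact hprior.maximalBallCentresConverge_bayesPosterior hφ hM
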